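/- Let $\mathbb R^3_1$ be $\mathbb R^3$ with the Lorentzian metric $\langle u,v\rangle=u_1v_1+u_2v_2-u_3v_3$ and the Lorentzian cross product $u\boxtimes v=(u_2v_3-u_3v_2,\;u_3v_1-u_1v_3,\;u_2v_1-u_1v_2)$, let $\mathbb H^2=\{u\in\mathbb R^3_1:\langle u,u\rangle=-1,\ u_3>0\}$ be the hyperbolic plane, and give $\mathbb H^2\times\mathbb R$ the product metric. Let $F:M\to\mathbb H^2\times\mathbb R$ be a smooth immersion of a surface $M$, which carries the induced metric, with a smooth unit normal field $\xi$ and shape operator $A$, defined by $\widetilde\nabla_X\xi=-dF(AX)$. Let $\theta\in[0,\pi]$ be its angle function, $\cos\theta=\widetilde g(\partial_t,\xi)$, and let $T$ be the projection of $\partial_t$ to the tangent planes of $M$, so that $\partial_t=dF(T)+\cos\theta\,\xi$. Assume that $\theta$ never takes the values $0$, $\pi/2$ and $\pi$. Then $T$ is a principal direction at every point of $M$ (that is, $T\neq0$ and $AT$ is a multiple of $T$) if and only if, up to a rigid motion (isometry) of $\mathbb H^2\times\mathbb R$, near every point of $M$ there are local coordinates $(x,y)$, ranging over a product of two open intervals,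 in which $$F(x,y)=\bigl(f(y)\cosh\phi(x)+N_f(y)\sinh\phi(x),\ \chi(x)\bigr),$$ where $f$ is a smooth regular curve in $\mathbb H^2$, $N_f=\dfrac{f\boxtimes f'}{\sqrt{\langle f',f'\rangle}}$ is its normal, and $(\phi,\chi)$ is a smooth regular curve in $\mathbb R^2$ whose angle function is the angle function $\theta$ of the surface so parametrized: $(\phi',\chi')=\sqrt{\phi'^2+\chi'^2}\,(\cos\theta,\sin\theta)$. Moreover, for the "if" part the condition on the angle functions is not needed, and the rigid motion may vary from point to point; and in every representation of this form the angle functions of the surface and of the curve agree, after a suitable choice of the unit normal of the surface and of the direction in which the curve is traversed. -/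

import Mathlib

open scoped Manifold ContDiff

namespace H2R

noncomputable section

/-- The Minkowski 3-space `ℝ₁³` (as a vector space; the metric is `lor`). -/
abbrev Mink : Type := Fin 3 → ℝ

/-- The space `ℝ₁⁴ = ℝ₁³ × ℝ`, which contains `ℍ² × ℝ`. -/
abbrev Amb : Type := Mink × ℝ

/-- The Lorentzian metric `dx₁² + dx₂² - dx₃²` of `ℝ₁³`. -/
def lor (u v : Mink) : ℝ := u 0 * v 0 + u 1 * v 1 - u 2 * v 2

/-- The Lorentzian cross product `u ⊠ v` of `ℝ₁³`. -/
def lorCross (u v : Mink) : Mink :=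
  ![u 1 * v 2 - u 2 * v 1, u 2 * v 0 - u 0 * v 2, u 1 * v 0 - u 0 * v 1]

/-- The hyperbolic plane: the upper sheet of the hyperboloid `⟨u, u⟩ = -1`. -/
def hyp : Set Mink := {u | lor u u = -1 ∧ 0 < u 2}

/-- The product `ℍ² × ℝ` inside `ℝ₁⁴`. -/
def hypR : Set Amb := {q | q.1 ∈ hyp}

/-- The metric `dx₁² + dx₂² - dx₃² + dt²` of `ℝ₁⁴`; its restriction to the tangent spaces of
`ℍ² × ℝ` is the product metric. -/
def metric (v w : Amb) : ℝ := lor v.1 w.1 + v.2 * w.2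

/-- The unit vector field `∂ₜ` tangent to the `ℝ`-direction. -/
def dt : Amb := (0, 1)

/-- The orthogonal projection of `ℝ₁⁴` onto the tangent space of `ℍ² × ℝ` at `q`
(the normal space is spanned by `(q.1, 0)`, of square `-1`). -/
def proj (q v : Amb) : Amb := (v.1 + lor v.1 q.1 • q.1, v.2)

section Surface

variable {M : Type*} [TopologicalSpace M] [ChartedSpace (EuclideanSpace ℝ (Fin 2)) M]

/-- The differential of `F` at `p`, as a linear map into `ℝ₁⁴`. -/
def diff (F : M → Amb) (p : M) : TangentSpace (𝓡 2) p →L[ℝ] Amb :=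
  mfderiv (𝓡 2) 𝓘(ℝ, Amb) F p

/-- `F : M → ℍ² × ℝ` is a smooth immersion of a surface (endowed with the induced metric), and
`ξ` is a smooth unit normal vector field of it in `ℍ² × ℝ`. -/
structure IsOrientedSurface (F ξ : M → Amb) : Prop where
  smooth : ContMDiff (𝓡 2) 𝓘(ℝ, Amb) ∞ F
  mem : ∀ p, F p ∈ hypR
  immersion : ∀ p, Function.Injective (diff F p)
  smooth_normal : ContMDiff (𝓡 2) 𝓘(ℝ, Amb) ∞ ξ
  /-- `ξ p` is tangent to `ℍ² × ℝ` at `F p`. -/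
  tangent : ∀ p, lor (ξ p).1 (F p).1 = 0
  unit : ∀ p, metric (ξ p) (ξ p) = 1
  normal : ∀ (p : M) (X : TangentSpace (𝓡 2) p), metric (diff F p X) (ξ p) = 0

/-- The angle function `θ ∈ [0, π]`: the angle between `∂ₜ` and the unit normal. -/
def angle (ξ : M → Amb) (p : M) : ℝ := Real.arccos (metric dt (ξ p))

/-- The tangent vector `X` at `p` with `dF(X) = w`, for `w` tangent to the immersed surface. -/
def pull (F : M → Amb) (p : M) (w : Amb) : TangentSpace (𝓡 2) p :=
  letI : Nonempty (TangentSpace (𝓡 2) p) := ⟨0⟩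
  Function.invFun (diff F p) w

/-- The vector field `T`, the projection of `∂ₜ` to the surface: `∂ₜ = dF(T) + cos θ ξ`. -/
def tangentPart (F ξ : M → Amb) (p : M) : TangentSpace (𝓡 2) p :=
  pull F p (dt - Real.cos (angle ξ p) • ξ p)

/-- The derivative of `ξ` along the tangent vector `X` with respect to the Levi-Civita connection
of `ℍ² × ℝ`, which is the tangential part of the derivative in `ℝ₁⁴`. -/
def covDeriv (F ξ : M → Amb) (p : M) (X : TangentSpace (𝓡 2) p) : Amb :=
  proj (F p) (diff ξ p X)

/-- The shape operator `A`, given by the Weingarten formula: the derivative of `ξ` along `X` with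
respect to the Levi-Civita connection of `ℍ² × ℝ` is `-dF(A X)`. -/
def shapeOp (F ξ : M → Amb) (p : M) (X : TangentSpace (𝓡 2) p) : TangentSpace (𝓡 2) p :=
  pull F p (-covDeriv F ξ p X)

/-- `T` is a principal direction at every point: a non-zero eigenvector of the shape operator. -/
def IsPrincipalT (F ξ : M → Amb) : Prop :=
  ∀ p, tangentPart F ξ p ≠ 0 ∧
    ∃ k : ℝ, shapeOp F ξ p (tangentPart F ξ p) = k • tangentPart F ξ p

end Surface

/-- The rigid motions (isometries) of `ℍ² × ℝ`: an isometry of `ℍ²`, that is a Lorentz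
transformation which preserves the upper sheet, on the first factor and
`t ↦ ±t + c` on the second. -/
structure RigidMotion where
  lin : Mink ≃ₗ[ℝ] Mink
  lin_lor : ∀ u v, lor (lin u) (lin v) = lor u v
  lin_mem : ∀ u ∈ hyp, lin u ∈ hyp
  sgn : ℝ
  sgn_eq : sgn = 1 ∨ sgn = -1
  shift : ℝ

/-- The action of a rigid motion on points. -/
def RigidMotion.act (Φ : RigidMotion) (q : Amb) : Amb := (Φ.lin q.1, Φ.sgn * q.2 + Φ.shift)

/-- The differential of a rigid motion. -/
def RigidMotion.dact (Φ : RigidMotion) (v : Amb) : Amb := (Φ.lin v.1, Φ.sgn * v.2)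

/-- The normal `N_f = (f ⊠ f') / √⟨f', f'⟩` of a curve in `ℍ²`. -/
def curveNormal (f : ℝ → Mink) (y : ℝ) : Mink :=
  (Real.sqrt (lor (deriv f y) (deriv f y)))⁻¹ • lorCross (f y) (deriv f y)

/-- The speed of the plane curve `(φ, χ)`. -/
def speed (φ χ : ℝ → ℝ) (x : ℝ) : ℝ := Real.sqrt (deriv φ x ^ 2 + deriv χ x ^ 2)

/-- `α` is the angle of the plane curve `(φ, χ)` at `x`: its velocity is
`speed • (cos α, sin α)`. -/
def IsCurveAngle (φ χ : ℝ → ℝ) (x α : ℝ) : Prop :=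
  deriv φ x = speed φ χ x * Real.cos α ∧ deriv χ x = speed φ χ x * Real.sin α

/-- In the smooth local coordinates `e = (x, y)` of `M`, which range over the product `I × J` of
two open intervals, the map `G : M → ℍ² × ℝ` is
`G(x, y) = (f(y) cosh φ(x) + N_f(y) sinh φ(x), χ(x))`,
with a regular curve `f` in `ℍ²` and a regular plane curve `(φ, χ)`. -/
structure IsNormalForm {M : Type*} [TopologicalSpace M] [ChartedSpace (EuclideanSpace ℝ (Fin 2)) M]
    (G : M → Amb) (e : OpenPartialHomeomorph M (EuclideanSpace ℝ (Fin 2)))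
    (I J : Set ℝ) (f : ℝ → Mink) (φ χ : ℝ → ℝ) : Prop where
  chart : e ∈ IsManifold.maximalAtlas (𝓡 2) ∞ M
  isOpen_I : IsOpen I
  interval_I : I.OrdConnected
  isOpen_J : IsOpen J
  interval_J : J.OrdConnected
  target : e.target = {v | v 0 ∈ I ∧ v 1 ∈ J}
  smooth_f : ContDiffOn ℝ ∞ f J
  f_mem : ∀ y ∈ J, f y ∈ hyp
  f_regular : ∀ y ∈ J, deriv f y ≠ 0
  smooth_φ : ContDiffOn ℝ ∞ φ I
  smooth_χ : ContDiffOn ℝ ∞ χ I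
  regular : ∀ x ∈ I, deriv φ x ≠ 0 ∨ deriv χ x ≠ 0
  formula : ∀ q ∈ e.source,
    G q = (Real.cosh (φ (e q 0)) • f (e q 1) + Real.sinh (φ (e q 0)) • curveNormal f (e q 1),
      χ (e q 0))

end

end H2R

open H2R

namespace H2R

/-! ### Algebra of Minkowski space -/

/-! Write `g = (g₁, h)` for the surface in a chart, `n` for its unit normal and `c = n.2 = cos θ`.

Suppose `T` is principal. Symmetry of the second fundamental form turns `AT ∥ T` into `dc ∥ dh`
(`IsLocalSurface.fderiv_normal_snd`). Since `dh(T) = sin² θ ≠ 0`, the angle is locally a function of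
the height, and so is a primitive `φ` of `cot θ` with respect to `h` (`exists_primitive`). Let `E =
-n.1 / sin θ`, a unit vector tangent to `ℍ²`. Along `T`, both `dg₁ = cos θ sin θ E` and `dE = cos θ
sin θ g₁` hold, while `dφ(T) = cos θ sin θ`. The pair `(g₁, E)` therefore moves along a geodesic of
`ℍ²` with arc length `φ`, and undoing the hyperbolic rotation by `φ` gives a point `foot` and a
direction `footDir` that are constant along `T` (`fderiv_foot_of_principal`). In the coordinates `x
= h` and `y` = a multiple of a component of the foot, they become functions `f` and `N` of `y`
alone. A Gauss lemma (`lor_fderiv_foot`) makes `N` orthogonal to `f'`, so `N = ±N_f`, and the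
orientation of `y` is chosen to make the sign `+`. Here `χ = id`.

Conversely, in the normal form `N_f'` is parallel to `f'`, so the coordinate vectors are `(φ' E,
χ')` and a multiple of `(f', 0)`. The normal is then `(a E, c)` with `(a, c)` a unit normal of the
plane curve. Both `T` and the derivative of the normal in the direction of `x` are multiples of the
first coordinate vector, so `T` is principal (`IsCoordNormalForm.isLocallyPrincipal`). Orthogonality
of `(a, c)` and `(φ', χ')` also gives the agreement of the angles up to signs, which are constant
because a box is connected (`exists_signs`).

The computations take place in open subsets of the plane. Charts transfer them to `M`, and rigid
motions preserve every notion involved up to the sign of `T`. -/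

theorem mink_ext {u v : Mink} (h0 : u 0 = v 0) (h1 : u 1 = v 1) (h2 : u 2 = v 2) : u = v := by
  funext i
  fin_cases i <;> assumption

theorem lor_comm (u v : Mink) : lor u v = lor v u := by
  unfold lor; ring

theorem lor_add_left (u v w : Mink) : lor (u + v) w = lor u w + lor v w := by
  simp only [lor, Pi.add_apply]; ring

theorem lor_add_right (u v w : Mink) : lor u (v + w) = lor u v + lor u w := by
  simp only [lor, Pi.add_apply]; ring

theorem lor_sub_left (u v w : Mink) : lor (u - v) w = lor u w - lor v w := by
  simp only [lor, Pi.sub_apply]; ring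

theorem lor_sub_right (u v w : Mink) : lor u (v - w) = lor u v - lor u w := by
  simp only [lor, Pi.sub_apply]; ring

theorem lor_smul_left (r : ℝ) (u v : Mink) : lor (r • u) v = r * lor u v := by
  simp only [lor, Pi.smul_apply, smul_eq_mul]; ring

theorem lor_smul_right (r : ℝ) (u v : Mink) : lor u (r • v) = r * lor u v := by
  simp only [lor, Pi.smul_apply, smul_eq_mul]; ring

theorem lor_neg_left (u v : Mink) : lor (-u) v = -lor u v := by
  simp only [lor, Pi.neg_apply]; ring

theorem lor_zero_left (v : Mink) : lor 0 v = 0 := by simp [lor]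

theorem lor_zero_right (v : Mink) : lor v 0 = 0 := by simp [lor]

theorem lor_lorCross_left (u v : Mink) : lor u (lorCross u v) = 0 := by
  simp [lor, lorCross]; ring

theorem lor_lorCross_right (u v : Mink) : lor v (lorCross u v) = 0 := by
  simp [lor, lorCross]; ring

theorem lor_lorCross_self (u v : Mink) :
    lor (lorCross u v) (lorCross u v) = lor u v ^ 2 - lor u u * lor v v := by
  simp [lor, lorCross]; ring

/-- A vector orthogonal to `u` and `a` is parallel to `u ⊠ a`. -/
theorem lorCross_parallel {u a w : Mink} (hu : lor w u = 0) (ha : lor w a = 0) :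
    lor (lorCross u a) (lorCross u a) • w = lor w (lorCross u a) • lorCross u a := by
  unfold lor at hu ha
  refine mink_ext ?_ ?_ ?_ <;> simp [lor, lorCross]
  · linear_combination (u 2 * a 0 - u 0 * a 2) * (u 2 * ha - a 2 * hu) -
      (u 1 * a 0 - u 0 * a 1) * (u 1 * ha - a 1 * hu)
  · linear_combination -(u 1 * a 2 - u 2 * a 1) * (u 2 * ha - a 2 * hu) -
      (u 1 * a 0 - u 0 * a 1) * (a 0 * hu - u 0 * ha)
  · linear_combination -(u 1 * a 2 - u 2 * a 1) * (u 1 * ha - a 1 * hu) -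
      (u 2 * a 0 - u 0 * a 2) * (a 0 * hu - u 0 * ha)

/-- A vector tangent to the hyperbolic plane is spacelike. -/
theorem lor_self_pos {u a : Mink} (hu : u ∈ hyp) (ha : a ≠ 0) (h : lor u a = 0) :
    0 < lor a a := by
  obtain ⟨h1, h2⟩ := hu
  unfold lor at *
  -- Tangency eliminates `u 2 * a 2`, and `u 2 ^ 2 = 1 + u 0 ^ 2 + u 1 ^ 2`; Lagrange's identity for
  -- the first two components then leaves a sum of squares.
  have key : u 2 ^ 2 * (a 0 * a 0 + a 1 * a 1 - a 2 * a 2) =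
      a 0 ^ 2 + a 1 ^ 2 + (u 0 * a 1 - u 1 * a 0) ^ 2 := by
    linear_combination (u 0 * a 0 + u 1 * a 1 + u 2 * a 2) * h - (a 0 ^ 2 + a 1 ^ 2) * h1
  by_contra hn
  have h3 : a 0 ^ 2 + a 1 ^ 2 + (u 0 * a 1 - u 1 * a 0) ^ 2 ≤ 0 := by
    rw [← key]; exact mul_nonpos_of_nonneg_of_nonpos (by positivity) (not_lt.1 hn)
  have h4 : a 0 = 0 := by
    nlinarith [sq_nonneg (a 0), sq_nonneg (a 1), sq_nonneg (u 0 * a 1 - u 1 * a 0)]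
  have h5 : a 1 = 0 := by
    nlinarith [sq_nonneg (a 0), sq_nonneg (a 1), sq_nonneg (u 0 * a 1 - u 1 * a 0)]
  have h6 : a 2 = 0 := by
    rw [h4, h5] at h
    have : u 2 * a 2 = 0 := by linarith
    exact (mul_eq_zero.1 this).resolve_left h2.ne'
  exact ha (mink_ext h4 h5 h6)

theorem lor_self_nonneg {u a : Mink} (hu : u ∈ hyp) (h : lor u a = 0) : 0 ≤ lor a a := by
  by_cases ha : a = 0
  · simp [ha, lor]
  · exact (lor_self_pos hu ha h).le

/-- In the tangent space of the hyperbolic plane at `u`, the orthogonal complement of `a ≠ 0` is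
spanned by any unit vector `E` it contains. -/
theorem eq_lor_smul_of_orthogonal {u a E w : Mink} (hu : u ∈ hyp) (ha : a ≠ 0) (hua : lor u a = 0)
    (hEu : lor E u = 0) (hEa : lor E a = 0) (hE : lor E E = 1)
    (hwu : lor w u = 0) (hwa : lor w a = 0) : w = lor w E • E := by
  -- Both `w` and `E` are multiples of the spacelike vector `u ⊠ a`; comparing the two multiples
  -- avoids any dimension count.
  set m := lorCross u a with hm
  have hq : 0 < lor m m := by
    rw [hm, lor_lorCross_self, hua, hu.1]
    have := lor_self_pos hu ha hua
    linarith
  have h1 : w = (lor w m / lor m m) • m := by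
    rw [div_eq_inv_mul, mul_smul, ← lorCross_parallel hwu hwa, smul_smul, inv_mul_cancel₀ hq.ne',
      one_smul]
  have h2 : E = (lor E m / lor m m) • m := by
    rw [div_eq_inv_mul, mul_smul, ← lorCross_parallel hEu hEa, smul_smul, inv_mul_cancel₀ hq.ne',
      one_smul]
  generalize lor w m / lor m m = α at h1
  generalize lor E m / lor m m = β at h2
  have h3 : β * β * lor m m = 1 := by
    rw [← hE, h2, lor_smul_left, lor_smul_right]; ring
  rw [h1, h2, lor_smul_left, lor_smul_right, smul_smul]
  congr 1
  linear_combination -α * h3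

/-- A unit timelike vector on the same side as a point of the hyperbolic plane lies in it. -/
theorem mem_hyp_of_lor_neg {u v : Mink} (hu : u ∈ hyp) (hv : lor v v = -1) (h : lor v u < 0) :
    v ∈ hyp := by
  refine ⟨hv, ?_⟩
  obtain ⟨h1, h2⟩ := hu
  by_contra hn
  unfold lor at *
  -- If `v 2 ≤ 0`, then `v 0 * u 0 + v 1 * u 1 < u 2 * v 2 ≤ 0`, and squaring contradicts the
  -- Cauchy–Schwarz inequality because `u 2 ^ 2` and `v 2 ^ 2` exceed the squared lengths of the
  -- planar parts by `1`.
  have h3 : 0 ≤ u 2 * (-v 2) := mul_nonneg h2.le (by linarith)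
  have h4 : (u 2 * v 2) ^ 2 < (v 0 * u 0 + v 1 * u 1) ^ 2 := by nlinarith
  nlinarith [sq_nonneg (v 0 * u 1 - v 1 * u 0), sq_nonneg (u 2), sq_nonneg (v 0), sq_nonneg (v 1),
    sq_nonneg (u 0), sq_nonneg (u 1)]

/-! ### Derivatives of the Lorentzian product -/

section Calculus

variable {V : Type*} [NormedAddCommGroup V] [NormedSpace ℝ V]

theorem hasFDerivAt_lor {a b : V → Mink} {a' b' : V →L[ℝ] Mink} {v : V}
    (ha : HasFDerivAt a a' v) (hb : HasFDerivAt b b' v) :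
    ∃ l : V →L[ℝ] ℝ, HasFDerivAt (fun x => lor (a x) (b x)) l v ∧
      ∀ X, l X = lor (a' X) (b v) + lor (a v) (b' X) := by
  have hai := fun i => hasFDerivAt_pi'.1 ha i
  have hbi := fun i => hasFDerivAt_pi'.1 hb i
  refine ⟨_, (((hai 0).mul (hbi 0)).add ((hai 1).mul (hbi 1))).sub ((hai 2).mul (hbi 2)), ?_⟩
  intro X
  simp [lor]
  ring

theorem hasFDerivAt_metric {a b : V → Amb} {a' b' : V →L[ℝ] Amb} {v : V}
    (ha : HasFDerivAt a a' v) (hb : HasFDerivAt b b' v) :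
    ∃ l : V →L[ℝ] ℝ, HasFDerivAt (fun x => metric (a x) (b x)) l v ∧
      ∀ X, l X = metric (a' X) (b v) + metric (a v) (b' X) := by
  obtain ⟨l, hl, hl'⟩ := hasFDerivAt_lor ha.fst hb.fst
  refine ⟨_, hl.add (ha.snd.mul hb.snd), ?_⟩
  intro X
  simp [metric, hl']
  ring

/-- Differentiating a Lorentzian product which is constant near a point. -/
theorem lor_fderiv_add_eq_zero {a b : V → Mink} {a' b' : V →L[ℝ] Mink} {v : V}
    (ha : HasFDerivAt a a' v) (hb : HasFDerivAt b b' v) {c : ℝ}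
    (h : ∀ᶠ x in nhds v, lor (a x) (b x) = c) (X : V) :
    lor (a' X) (b v) + lor (a v) (b' X) = 0 := by
  obtain ⟨l, hl, hl'⟩ := hasFDerivAt_lor ha hb
  rw [← hl', hl.unique ((hasFDerivAt_const c v).congr_of_eventuallyEq h)]
  rfl

theorem metric_fderiv_add_eq_zero {a b : V → Amb} {a' b' : V →L[ℝ] Amb} {v : V}
    (ha : HasFDerivAt a a' v) (hb : HasFDerivAt b b' v) {c : ℝ}
    (h : ∀ᶠ x in nhds v, metric (a x) (b x) = c) (X : V) :
    metric (a' X) (b v) + metric (a v) (b' X) = 0 := by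
  obtain ⟨l, hl, hl'⟩ := hasFDerivAt_metric ha hb
  rw [← hl', hl.unique ((hasFDerivAt_const c v).congr_of_eventuallyEq h)]
  rfl

theorem lor_deriv_add_eq_zero {a b : ℝ → Mink} {a' b' : Mink} {y : ℝ}
    (ha : HasDerivAt a a' y) (hb : HasDerivAt b b' y) {c : ℝ}
    (h : ∀ᶠ x in nhds y, lor (a x) (b x) = c) : lor a' (b y) + lor (a y) b' = 0 := by
  simpa using lor_fderiv_add_eq_zero ha.hasFDerivAt hb.hasFDerivAt h 1

theorem contDiffOn_lor {a b : V → Mink} {s : Set V} {k : WithTop ℕ∞} (ha : ContDiffOn ℝ k a s)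
    (hb : ContDiffOn ℝ k b s) : ContDiffOn ℝ k (fun x => lor (a x) (b x)) s := by
  have hai := fun i => contDiffOn_pi.1 ha i
  have hbi := fun i => contDiffOn_pi.1 hb i
  exact (((hai 0).mul (hbi 0)).add ((hai 1).mul (hbi 1))).sub ((hai 2).mul (hbi 2))

theorem contDiffOn_lorCross {a b : V → Mink} {s : Set V} {k : WithTop ℕ∞}
    (ha : ContDiffOn ℝ k a s) (hb : ContDiffOn ℝ k b s) :
    ContDiffOn ℝ k (fun x => lorCross (a x) (b x)) s := by
  have hai := fun i => contDiffOn_pi.1 ha i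
  have hbi := fun i => contDiffOn_pi.1 hb i
  refine contDiffOn_pi.2 fun i => ?_
  fin_cases i
  · exact ((hai 1).mul (hbi 2)).sub ((hai 2).mul (hbi 1))
  · exact ((hai 2).mul (hbi 0)).sub ((hai 0).mul (hbi 2))
  · exact ((hai 1).mul (hbi 0)).sub ((hai 0).mul (hbi 1))

/-- A continuous function without zeros on a preconnected set has constant sign. -/
theorem exists_sign_of_ne_zero {X : Type*} [TopologicalSpace X] {s : Set X} {h : X → ℝ}
    (hs : IsPreconnected s) (hc : ContinuousOn h s) (h0 : ∀ x ∈ s, h x ≠ 0) :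
    ∃ σ : ℝ, (σ = 1 ∨ σ = -1) ∧ ∀ x ∈ s, 0 < σ * h x := by
  by_cases hp : ∀ x ∈ s, 0 < h x
  · exact ⟨1, Or.inl rfl, fun x hx => by simpa using hp x hx⟩
  · push Not at hp
    obtain ⟨a, ha, hna⟩ := hp
    refine ⟨-1, Or.inr rfl, fun x hx => ?_⟩
    by_contra hx'
    have hx0 : 0 ≤ h x := by linarith
    obtain ⟨z, hz, hz0⟩ := hs.intermediate_value ha hx hc ⟨hna, hx0⟩
    exact h0 z hz hz0

/-- A smooth function on an open interval has a smooth antiderivative. -/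
theorem exists_antiderivative {I : Set ℝ} (hI : IsOpen I) (hI' : I.OrdConnected) {g : ℝ → ℝ}
    (hg : ContDiffOn ℝ ∞ g I) {x₀ : ℝ} (hx₀ : x₀ ∈ I) :
    ∃ ψ : ℝ → ℝ, ψ x₀ = 0 ∧ ContDiffOn ℝ ∞ ψ I ∧ ∀ x ∈ I, HasDerivAt ψ (g x) x := by
  have hd : ∀ x ∈ I, HasDerivAt (fun x => ∫ t in x₀..x, g t) (g x) x := by
    intro x hx
    refine intervalIntegral.integral_hasDerivAt_right ?_ ?_ ?_
    · exact (hg.continuousOn.mono (hI'.uIcc_subset hx₀ hx)).intervalIntegrable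
    · exact hg.continuousOn.stronglyMeasurableAtFilter hI x hx
    · exact hg.continuousOn.continuousAt (hI.mem_nhds hx)
  refine ⟨_, intervalIntegral.integral_same, ?_, hd⟩
  rw [contDiffOn_infty_iff_deriv_of_isOpen hI]
  exact ⟨fun x hx => (hd x hx).differentiableAt.differentiableWithinAt,
    hg.congr fun x hx => (hd x hx).deriv⟩

end Calculus

/-! ### Coordinate changes of the plane with values in a box -/

/-- The coordinate plane. -/
abbrev Plane : Type := EuclideanSpace ℝ (Fin 2)

theorem plane_ext {v w : Plane} (h0 : v 0 = w 0) (h1 : v 1 = w 1) : v = w := by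
  ext i
  fin_cases i <;> assumption

/-- The level directions of a coordinate of the plane form a line, so a linear map that kills one
non-zero level direction kills them all. -/
theorem exists_smul_of_apply_eq_zero {Z Z₀ : Plane} {i : Fin 2} (hZ : Z i = 0) (hZ₀ : Z₀ i = 0)
    (h0 : Z₀ ≠ 0) : ∃ r : ℝ, Z = r • Z₀ := by
  fin_cases i
  · have h1 : Z₀ 1 ≠ 0 := fun h => h0 (plane_ext (by simpa using hZ₀) (by simpa using h))
    refine ⟨Z 1 / Z₀ 1, plane_ext ?_ ?_⟩
    · simp only [Fin.zero_eta] at hZ hZ₀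
      simp [hZ, hZ₀]
    · simp [h1]
  · have h1 : Z₀ 0 ≠ 0 := fun h => h0 (plane_ext (by simpa using h) (by simpa using hZ₀))
    refine ⟨Z 0 / Z₀ 0, plane_ext ?_ ?_⟩
    · simp [h1]
    · simp only [Fin.mk_one] at hZ hZ₀
      simp [hZ, hZ₀]

theorem hasFDerivAt_plane_apply {V : Type*} [NormedAddCommGroup V] [NormedSpace ℝ V]
    {H : V → Plane} {H' : V →L[ℝ] Plane} {v : V} (h : HasFDerivAt H H' v) (i : Fin 2) :
    HasFDerivAt (fun w => H w i) ((EuclideanSpace.proj i : Plane →L[ℝ] ℝ).comp H') v :=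
  (EuclideanSpace.proj i : Plane →L[ℝ] ℝ).hasFDerivAt.comp v h

/-- `κ` is a smooth change of coordinates onto the product `K 0 × K 1` of two open intervals. -/
structure IsBoxChart (κ : OpenPartialHomeomorph Plane Plane) (K : Fin 2 → Set ℝ) : Prop where
  smooth : ContDiffOn ℝ ∞ κ κ.source
  smooth_symm : ContDiffOn ℝ ∞ κ.symm κ.target
  isOpen : ∀ i, IsOpen (K i)
  interval : ∀ i, (K i).OrdConnected
  target : κ.target = {v | ∀ i, v i ∈ K i}

/-- Two functions with independent differentials at a point are coordinates near it. -/
theorem exists_isBoxChart {a b : Plane → ℝ} {U : Set Plane} (hU : IsOpen U)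
    (ha : ContDiffOn ℝ ∞ a U) (hb : ContDiffOn ℝ ∞ b U) {v₀ : Plane} (hv₀ : v₀ ∈ U) {X Y : Plane}
    (haX : fderiv ℝ a v₀ X ≠ 0) (hbX : fderiv ℝ b v₀ X = 0) (hbY : fderiv ℝ b v₀ Y ≠ 0) :
    ∃ κ K, IsBoxChart κ K ∧ v₀ ∈ κ.source ∧ κ.source ⊆ U ∧
      ∀ v ∈ κ.source, κ v 0 = a v ∧ κ v 1 = b v := by
  set H : Plane → Plane := fun v => WithLp.toLp 2 ![a v, b v] with hH
  have hHs : ContDiffOn ℝ ∞ H U := by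
    rw [contDiffOn_euclidean]
    intro i
    fin_cases i
    · exact ha
    · exact hb
  have hHat : ∀ v ∈ U, ContDiffAt ℝ ∞ H v := fun v hv => hHs.contDiffAt (hU.mem_nhds hv)
  have hHd : ∀ v ∈ U, HasFDerivAt H (fderiv ℝ H v) v := fun v hv =>
    ((hHat v hv).differentiableAt (by simp)).hasFDerivAt
  have hda := (ha.contDiffAt (hU.mem_nhds hv₀)).differentiableAt (by simp)
  have hdb := (hb.contDiffAt (hU.mem_nhds hv₀)).differentiableAt (by simp)
  have h0 : ∀ Z, fderiv ℝ H v₀ Z 0 = fderiv ℝ a v₀ Z := by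
    intro Z
    have h1 := hasFDerivAt_plane_apply (hHd v₀ hv₀) 0
    have h2 : HasFDerivAt (fun v => H v 0) (fderiv ℝ a v₀) v₀ := hda.hasFDerivAt
    rw [h2.unique h1]
    rfl
  have h1 : ∀ Z, fderiv ℝ H v₀ Z 1 = fderiv ℝ b v₀ Z := by
    intro Z
    have h1 := hasFDerivAt_plane_apply (hHd v₀ hv₀) 1
    have h2 : HasFDerivAt (fun v => H v 1) (fderiv ℝ b v₀) v₀ := hdb.hasFDerivAt
    rw [h2.unique h1]
    rfl
  have hsurj : Function.Surjective (fderiv ℝ H v₀).toLinearMap := by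
    intro Z
    -- The system is triangular because `X` is invisible to `b`: the coefficient of `Y` is read off
    -- from `b`, and that of `X` then from `a`.
    refine ⟨(Z 1 / fderiv ℝ b v₀ Y) • Y +
      ((Z 0 - Z 1 / fderiv ℝ b v₀ Y * fderiv ℝ a v₀ Y) / fderiv ℝ a v₀ X) • X,
      plane_ext ?_ ?_⟩
    · rw [ContinuousLinearMap.coe_coe, h0]
      simp only [map_add, map_smul, smul_eq_mul]
      field_simp
      ring
    · rw [ContinuousLinearMap.coe_coe, h1]
      simp only [map_add, map_smul, smul_eq_mul, hbX]
      field_simp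
      ring
  have hinj : Function.Injective (fderiv ℝ H v₀).toLinearMap :=
    LinearMap.injective_iff_surjective.2 hsurj
  let L₀ : Plane ≃L[ℝ] Plane :=
    (LinearEquiv.ofBijective (fderiv ℝ H v₀).toLinearMap ⟨hinj, hsurj⟩).toContinuousLinearEquiv
  have hL₀ : (L₀ : Plane →L[ℝ] Plane) = fderiv ℝ H v₀ := by
    ext Z : 1
    rfl
  have hd₀ : HasFDerivAt H (L₀ : Plane →L[ℝ] Plane) v₀ := hL₀ ▸ hHd v₀ hv₀
  let κ₀ := (hHat v₀ hv₀).toOpenPartialHomeomorph H hd₀ (by simp)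
  -- Restricting to points with invertible differential makes the local inverse smooth on its whole
  -- domain, not only at the image of `v₀`.
  let W : Set Plane := U ∩ (fderiv ℝ H) ⁻¹'
    Set.range ((↑) : (Plane ≃L[ℝ] Plane) → Plane →L[ℝ] Plane)
  have hW : IsOpen W := by
    have hc : ContinuousOn (fderiv ℝ H) U := hHs.continuousOn_fderiv_of_isOpen hU (by simp)
    exact hc.isOpen_inter_preimage hU ContinuousLinearEquiv.isOpen
  have hW₀ : v₀ ∈ W := ⟨hv₀, L₀, hL₀⟩
  let κ₁ := κ₀.restrOpen W hW
  have hv₁ : v₀ ∈ κ₁.source :=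
    ⟨(hHat v₀ hv₀).mem_toOpenPartialHomeomorph_source hd₀ (by simp), hW₀⟩
  have hopen : IsOpen (WithLp.toLp 2 ⁻¹' κ₁.target : Set (Fin 2 → ℝ)) :=
    κ₁.open_target.preimage (PiLp.continuous_toLp 2 _)
  -- Balls are taken in `Fin 2 → ℝ` rather than in the Euclidean plane: a ball of the sup norm is a
  -- product of intervals.
  obtain ⟨r, hr, hball⟩ := Metric.isOpen_iff.1 hopen (WithLp.ofLp (κ₁ v₀)) (κ₁.map_source hv₁)
  let K : Fin 2 → Set ℝ := fun i => Metric.ball (κ₁ v₀ i) r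
  let B : Set Plane := {v | ∀ i, v i ∈ K i}
  have hBo : IsOpen B := by
    have : B = ⋂ i, (fun v : Plane => v i) ⁻¹' K i := by
      ext v; simp [B]
    rw [this]
    exact isOpen_iInter_of_finite fun i => Metric.isOpen_ball.preimage (by fun_prop)
  have hB : B ⊆ κ₁.target := by
    intro w hw
    have : WithLp.ofLp w ∈ Metric.ball (WithLp.ofLp (κ₁ v₀)) r := by
      exact (dist_pi_lt_iff hr).2 fun i => hw i
    exact hball this
  let κ := (κ₁.symm.restrOpen B hBo).symm
  have hκs : κ.source ⊆ κ₁.source := by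
    intro v hv
    have := κ.map_source hv
    have h2 : κ₁.symm (κ v) ∈ κ₁.source := κ₁.map_target this.1
    have h3 : κ₁.symm (κ v) = v := κ.left_inv hv
    rwa [h3] at h2
  have hκt : κ.target = B := Set.inter_eq_right.2 hB
  refine ⟨κ, K, ⟨?_, ?_, fun i => Metric.isOpen_ball, fun i => ?_, hκt⟩, ?_, ?_, ?_⟩
  · exact (hHs.mono fun v hv => (hκs hv).2.1)
  · intro w hw
    have hs := hκs (κ.map_target hw)
    obtain ⟨L, hL⟩ := hs.2.2
    refine ContDiffAt.contDiffWithinAt (κ.contDiffAt_symm (f₀' := L) hw ?_ (hHat _ hs.2.1))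
    rw [hL]
    exact hHd _ hs.2.1
  · simp only [K, Real.ball_eq_Ioo]
    exact Set.ordConnected_Ioo
  · have : κ₁ v₀ ∈ κ.target := by
      rw [hκt]
      exact fun i => Metric.mem_ball_self hr
    have h2 := κ.map_target this
    have h3 : κ.symm (κ₁ v₀) = v₀ := κ₁.left_inv hv₁
    rwa [h3] at h2
  · exact fun v hv => (hκs hv).2.1
  · exact fun v _ => ⟨rfl, rfl⟩

namespace IsBoxChart

variable {κ : OpenPartialHomeomorph Plane Plane} {K : Fin 2 → Set ℝ} (hκ : IsBoxChart κ K)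
include hκ

theorem hasFDerivAt {v : Plane} (hv : v ∈ κ.source) : HasFDerivAt κ (fderiv ℝ κ v) v :=
  ((hκ.smooth.contDiffAt (κ.open_source.mem_nhds hv)).differentiableAt (by simp)).hasFDerivAt

theorem hasFDerivAt_symm {w : Plane} (hw : w ∈ κ.target) :
    HasFDerivAt κ.symm (fderiv ℝ κ.symm w) w :=
  ((hκ.smooth_symm.contDiffAt (κ.open_target.mem_nhds hw)).differentiableAt (by simp)).hasFDerivAt

theorem fderiv_symm_fderiv {v : Plane} (hv : v ∈ κ.source) (X : Plane) :
    fderiv ℝ κ.symm (κ v) (fderiv ℝ κ v X) = X := by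
  have h1 := (hκ.hasFDerivAt_symm (κ.map_source hv)).comp v (hκ.hasFDerivAt hv)
  have h2 : HasFDerivAt (κ.symm ∘ κ) (ContinuousLinearMap.id ℝ Plane) v :=
    (hasFDerivAt_id v).congr_of_eventuallyEq (by
      filter_upwards [κ.open_source.mem_nhds hv] with w hw using κ.left_inv hw)
  exact congrArg (fun l : Plane →L[ℝ] Plane => l X) (h1.unique h2)

theorem fderiv_fderiv_symm {v : Plane} (hv : v ∈ κ.source) (Z : Plane) :
    fderiv ℝ κ v (fderiv ℝ κ.symm (κ v) Z) = Z := by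
  have h3 : HasFDerivAt κ (fderiv ℝ κ v) (κ.symm (κ v)) := by
    rw [κ.left_inv hv]; exact hκ.hasFDerivAt hv
  have h1 := h3.comp (κ v) (hκ.hasFDerivAt_symm (κ.map_source hv))
  have h2 : HasFDerivAt (κ ∘ κ.symm) (ContinuousLinearMap.id ℝ Plane) (κ v) :=
    (hasFDerivAt_id _).congr_of_eventuallyEq (by
      filter_upwards [κ.open_target.mem_nhds (κ.map_source hv)] with w hw using κ.right_inv hw)
  exact congrArg (fun l : Plane →L[ℝ] Plane => l Z) (h1.unique h2)

theorem fderiv_apply {v : Plane} (hv : v ∈ κ.source) (i : Fin 2) (X : Plane) :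
    fderiv ℝ (fun w => κ w i) v X = fderiv ℝ κ v X i := by
  rw [(hasFDerivAt_plane_apply (hκ.hasFDerivAt hv) i).fderiv]
  rfl

theorem exists_fderiv_apply_ne_zero {v : Plane} (hv : v ∈ κ.source) (i : Fin 2) :
    ∃ X, fderiv ℝ (fun w => κ w i) v X ≠ 0 := by
  refine ⟨fderiv ℝ κ.symm (κ v) (EuclideanSpace.single i 1), ?_⟩
  rw [hκ.fderiv_apply hv, hκ.fderiv_fderiv_symm hv]
  simp

/-- A function whose differential kills a non-zero vector tangent to the level curves of the
`i`-th coordinate is a smooth function of that coordinate. -/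
theorem exists_eq_comp {E : Type*} [NormedAddCommGroup E] [NormedSpace ℝ E] {g : Plane → E}
    (hg : ContDiffOn ℝ ∞ g κ.source) (i : Fin 2)
    (hX : ∀ v ∈ κ.source, ∃ X ≠ 0, fderiv ℝ (fun w => κ w i) v X = 0 ∧ fderiv ℝ g v X = 0)
    {v₀ : Plane} (hv₀ : v₀ ∈ κ.source) :
    ∃ G : ℝ → E, ContDiffOn ℝ ∞ G (K i) ∧ ∀ v ∈ κ.source, g v = G (κ v i) := by
  have hgd : ∀ v ∈ κ.source, HasFDerivAt g (fderiv ℝ g v) v := fun v hv =>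
    ((hg.contDiffAt (κ.open_source.mem_nhds hv)).differentiableAt (by simp)).hasFDerivAt
  have hgs : ContDiffOn ℝ ∞ (g ∘ κ.symm) κ.target :=
    hg.comp hκ.smooth_symm fun w hw => κ.map_target hw
  have hgsd : ∀ w ∈ κ.target,
      HasFDerivAt (g ∘ κ.symm) ((fderiv ℝ g (κ.symm w)).comp (fderiv ℝ κ.symm w)) w := by
    intro w hw
    exact (hgd _ (κ.map_target hw)).comp w (hκ.hasFDerivAt_symm hw)
  have hzero : ∀ w ∈ κ.target, ∀ Z : Plane, Z i = 0 →
      fderiv ℝ g (κ.symm w) (fderiv ℝ κ.symm w Z) = 0 := by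
    intro w hw Z hZ
    have hv := κ.map_target hw
    obtain ⟨X, hX0, hX1, hX2⟩ := hX _ hv
    rw [hκ.fderiv_apply hv] at hX1
    have h0 : fderiv ℝ κ (κ.symm w) X ≠ 0 := by
      intro h
      apply hX0
      rw [← hκ.fderiv_symm_fderiv hv X, h, map_zero]
    obtain ⟨r, hr⟩ := exists_smul_of_apply_eq_zero hZ hX1 h0
    have h3 := hκ.fderiv_symm_fderiv hv X
    rw [κ.right_inv hw] at h3
    rw [hr, map_smul, map_smul, h3, hX2, smul_zero]
  let c := κ v₀
  have hc : c ∈ κ.target := κ.map_source hv₀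
  -- The coordinate line through the image of `v₀`; the function sought is `g` restricted to it.
  let γ : ℝ → Plane := fun x => c + (x - c i) • EuclideanSpace.single i (1 : ℝ)
  have hγi : ∀ x, γ x i = x := by intro x; simp [γ]
  have hγ : ∀ x ∈ K i, γ x ∈ κ.target := by
    intro x hx
    rw [hκ.target] at hc ⊢
    intro j
    by_cases hj : j = i
    · subst hj; rw [hγi]; exact hx
    · simpa [γ, hj] using hc j
  refine ⟨fun x => g (κ.symm (γ x)), ?_, ?_⟩
  · refine hgs.comp (t := κ.target) (ContDiff.contDiffOn ?_) hγ
    fun_prop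
  · intro v hv
    have hw := κ.map_source hv
    set w := κ v with hwd
    have hxK : w i ∈ K i := by
      rw [hκ.target] at hw; exact hw i
    have hq := hγ _ hxK
    set q := γ (w i) with hqd
    -- This segment joins the point of that line at the same level to `w`. It stays in the box by
    -- convexity, and its `i`-th coordinate is constant, so `g` is constant along it.
    let δ : ℝ → Plane := fun t => q + t • (w - q)
    have hδt : ∀ t ∈ Set.Icc (0 : ℝ) 1, δ t ∈ κ.target := by
      intro t ht
      rw [hκ.target] at hw hq ⊢
      intro j
      have := (hκ.interval j).convex (hq j) (hw j) (sub_nonneg.2 ht.2) ht.1 (by ring)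
      convert! this using 1
      simp [δ]; ring
    have hδd : ∀ t, HasDerivAt δ (w - q) t := by
      intro t
      simpa [δ] using ((hasDerivAt_id t).smul_const (w - q)).const_add q
    have hd : ∀ t ∈ Set.Icc (0 : ℝ) 1, HasDerivAt (fun t => g (κ.symm (δ t))) 0 t := by
      intro t ht
      have h1 := (hgsd _ (hδt t ht)).comp_hasDerivAt t (hδd t)
      have h2 := hzero _ (hδt t ht) (w - q) (by simp [hqd, hγi])
      rw [ContinuousLinearMap.comp_apply, h2] at h1
      exact h1
    have := constant_of_has_deriv_right_zero (a := (0 : ℝ)) (b := 1)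
      (fun t ht => (hd t ht).continuousAt.continuousWithinAt)
      (fun t ht => (hd t ⟨ht.1, ht.2.le⟩).hasDerivWithinAt) 1 (by simp)
    simp only [δ, one_smul, zero_smul, add_zero, add_sub_cancel] at this
    have hl : κ.symm w = v := κ.left_inv hv
    rw [hl] at this
    exact this

end IsBoxChart

/-! ### Surfaces in a coordinate domain -/

theorem metric_dt (v : Amb) : metric dt v = v.2 := by simp [metric, dt, lor]

theorem metric_comm (v w : Amb) : metric v w = metric w v := by
  unfold metric; rw [lor_comm]; ring

/-- `g : U → ℍ² × ℝ` is an immersion of an open subset of the plane, with unit normal `n`. -/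
structure IsLocalSurface (g n : Plane → Amb) (U : Set Plane) : Prop where
  isOpen : IsOpen U
  smooth : ContDiffOn ℝ ∞ g U
  mem : ∀ v ∈ U, (g v).1 ∈ hyp
  immersion : ∀ v ∈ U, Function.Injective (fderiv ℝ g v)
  smooth_normal : ContDiffOn ℝ ∞ n U
  tangent : ∀ v ∈ U, lor (n v).1 (g v).1 = 0
  unit : ∀ v ∈ U, metric (n v) (n v) = 1
  normal : ∀ v ∈ U, ∀ X, metric (fderiv ℝ g v X) (n v) = 0

/-- The projection of `∂ₜ` to the tangent plane of the surface `g` is principal or zero. -/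
def IsLocallyPrincipal (g n : Plane → Amb) (v : Plane) : Prop :=
  ∃ X, fderiv ℝ g v X = dt - (n v).2 • n v ∧
    ∃ k : ℝ, proj (g v) (fderiv ℝ n v X) = k • fderiv ℝ g v X

namespace IsLocalSurface

variable {g n : Plane → Amb} {U : Set Plane} (S : IsLocalSurface g n U)
include S

theorem mono {U' : Set Plane} (hU' : IsOpen U') (h : U' ⊆ U) : IsLocalSurface g n U' where
  isOpen := hU'
  smooth := S.smooth.mono h
  mem v hv := S.mem v (h hv)
  immersion v hv := S.immersion v (h hv)
  smooth_normal := S.smooth_normal.mono h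
  tangent v hv := S.tangent v (h hv)
  unit v hv := S.unit v (h hv)
  normal v hv := S.normal v (h hv)

theorem mem_nhds {v : Plane} (hv : v ∈ U) : U ∈ nhds v := S.isOpen.mem_nhds hv

theorem hasFDerivAt {v : Plane} (hv : v ∈ U) : HasFDerivAt g (fderiv ℝ g v) v :=
  ((S.smooth.contDiffAt (S.mem_nhds hv)).differentiableAt (by simp)).hasFDerivAt

theorem hasFDerivAt_normal {v : Plane} (hv : v ∈ U) : HasFDerivAt n (fderiv ℝ n v) v :=
  ((S.smooth_normal.contDiffAt (S.mem_nhds hv)).differentiableAt (by simp)).hasFDerivAt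

theorem lor_fderiv {v : Plane} (hv : v ∈ U) (X : Plane) :
    lor (fderiv ℝ g v X).1 (g v).1 = 0 := by
  have h := lor_fderiv_add_eq_zero (S.hasFDerivAt hv).fst (S.hasFDerivAt hv).fst (c := -1)
    (by filter_upwards [S.mem_nhds hv] with w hw using (S.mem w hw).1) X
  rw [lor_comm (g v).1] at h
  simp only [ContinuousLinearMap.comp_apply, ContinuousLinearMap.coe_fst'] at h
  linarith

theorem metric_fderiv_normal {v : Plane} (hv : v ∈ U) (X : Plane) :
    metric (fderiv ℝ n v X) (n v) = 0 := by
  have h := metric_fderiv_add_eq_zero (S.hasFDerivAt_normal hv) (S.hasFDerivAt_normal hv) (c := 1)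
    (by filter_upwards [S.mem_nhds hv] with w hw using S.unit w hw) X
  rw [metric_comm (n v)] at h
  linarith

end IsLocalSurface

/-! ### Curves in the hyperbolic plane -/

theorem lor_curveNormal_left (f : ℝ → Mink) (y : ℝ) : lor (curveNormal f y) (f y) = 0 := by
  rw [curveNormal, lor_smul_left, lor_comm (lorCross _ _), lor_lorCross_left, mul_zero]

theorem lor_curveNormal_deriv (f : ℝ → Mink) (y : ℝ) :
    lor (curveNormal f y) (deriv f y) = 0 := by
  rw [curveNormal, lor_smul_left, lor_comm (lorCross _ _), lor_lorCross_right, mul_zero]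

section Curve

variable {J : Set ℝ} {f : ℝ → Mink} (hJ : IsOpen J) (hf : ContDiffOn ℝ ∞ f J)
  (hmem : ∀ y ∈ J, f y ∈ hyp) (hreg : ∀ y ∈ J, deriv f y ≠ 0)
include hJ hf

theorem hasDerivAt_of_contDiffOn {y : ℝ} (hy : y ∈ J) : HasDerivAt f (deriv f y) y :=
  ((hf.contDiffAt (hJ.mem_nhds hy)).differentiableAt (by simp)).hasDerivAt

include hmem

theorem lor_deriv_eq_zero {y : ℝ} (hy : y ∈ J) : lor (f y) (deriv f y) = 0 := by
  have hd := hasDerivAt_of_contDiffOn hJ hf hy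
  have h := lor_deriv_add_eq_zero hd hd (c := -1)
    (by filter_upwards [hJ.mem_nhds hy] with x hx using (hmem x hx).1)
  rw [lor_comm] at h
  linarith

include hreg

theorem lor_deriv_self_pos {y : ℝ} (hy : y ∈ J) : 0 < lor (deriv f y) (deriv f y) :=
  lor_self_pos (hmem y hy) (hreg y hy) (lor_deriv_eq_zero hJ hf hmem hy)

theorem lor_curveNormal_self {y : ℝ} (hy : y ∈ J) :
    lor (curveNormal f y) (curveNormal f y) = 1 := by
  have hp := lor_deriv_self_pos hJ hf hmem hreg hy
  rw [curveNormal, lor_smul_left, lor_smul_right, lor_lorCross_self,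
    lor_deriv_eq_zero hJ hf hmem hy, (hmem y hy).1, ← mul_assoc, ← mul_inv,
    Real.mul_self_sqrt hp.le]
  field_simp
  ring

theorem contDiffOn_curveNormal : ContDiffOn ℝ ∞ (curveNormal f) J := by
  have hd : ContDiffOn ℝ ∞ (deriv f) J := ((contDiffOn_infty_iff_deriv_of_isOpen hJ).1 hf).2
  have hp : ∀ y ∈ J, lor (deriv f y) (deriv f y) ≠ 0 := fun y hy =>
    (lor_deriv_self_pos hJ hf hmem hreg hy).ne'
  refine ContDiffOn.smul (ContDiffOn.inv ((contDiffOn_lor hd hd).sqrt hp) ?_)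
    (contDiffOn_lorCross hf hd)
  exact fun y hy => (Real.sqrt_pos.2 (lor_deriv_self_pos hJ hf hmem hreg hy)).ne'

/-- The Frenet equation: `N_f'` is orthogonal to `N_f`, which is a unit vector, and to `f`, since
`⟨N_f, f⟩ = 0` and `⟨N_f, f'⟩ = 0`. In the tangent plane of `ℍ²` only multiples of `f'` remain. -/
theorem exists_hasDerivAt_curveNormal {y : ℝ} (hy : y ∈ J) :
    ∃ k : ℝ, HasDerivAt (curveNormal f) (k • deriv f y) y := by
  have hN := hasDerivAt_of_contDiffOn hJ (contDiffOn_curveNormal hJ hf hmem hreg) hy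
  have hfd := hasDerivAt_of_contDiffOn hJ hf hy
  have hp := lor_deriv_self_pos hJ hf hmem hreg hy
  set N' := deriv (curveNormal f) y
  have h1 := lor_deriv_add_eq_zero hN hN (c := 1)
    (by filter_upwards [hJ.mem_nhds hy] with x hx using lor_curveNormal_self hJ hf hmem hreg hx)
  rw [lor_comm (curveNormal f y)] at h1
  have h2 := lor_deriv_add_eq_zero hN hfd (c := 0)
    (Filter.Eventually.of_forall fun x => lor_curveNormal_left f x)
  rw [lor_curveNormal_deriv, add_zero] at h2
  have hN0 : curveNormal f y ≠ 0 := by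
    intro h
    have := lor_curveNormal_self hJ hf hmem hreg hy
    rw [h, lor_zero_left] at this
    exact zero_ne_one this
  have h3 := eq_lor_smul_of_orthogonal (u := f y) (a := curveNormal f y)
    (E := (Real.sqrt (lor (deriv f y) (deriv f y)))⁻¹ • deriv f y) (w := N') (hmem y hy) hN0
    (by rw [lor_comm, lor_curveNormal_left])
    (by rw [lor_smul_left, lor_comm (deriv f y) (f y), lor_deriv_eq_zero hJ hf hmem hy, mul_zero])
    (by rw [lor_smul_left, lor_comm (deriv f y) (curveNormal f y), lor_curveNormal_deriv, mul_zero])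
    (by
      rw [lor_smul_left, lor_smul_right, ← mul_assoc, ← mul_inv, Real.mul_self_sqrt hp.le,
        inv_mul_cancel₀ hp.ne'])
    h2 (by linarith)
  rw [smul_smul] at h3
  exact ⟨_, h3 ▸ hN⟩

end Curve

/-! ### The normal form in coordinates -/

/-- On `I × J`, the map `g` is `(x, y) ↦ (f(y) cosh φ(x) + N_f(y) sinh φ(x), χ(x))`, with regular
curves `f` and `(φ, χ)`. -/
structure IsCoordNormalForm (g : Plane → Amb) (I J : Set ℝ) (f : ℝ → Mink) (φ χ : ℝ → ℝ) :
    Prop where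
  isOpen_I : IsOpen I
  interval_I : I.OrdConnected
  isOpen_J : IsOpen J
  interval_J : J.OrdConnected
  smooth_f : ContDiffOn ℝ ∞ f J
  f_mem : ∀ y ∈ J, f y ∈ hyp
  f_regular : ∀ y ∈ J, deriv f y ≠ 0
  smooth_φ : ContDiffOn ℝ ∞ φ I
  smooth_χ : ContDiffOn ℝ ∞ χ I
  regular : ∀ x ∈ I, deriv φ x ≠ 0 ∨ deriv χ x ≠ 0
  formula : ∀ v : Plane, v 0 ∈ I → v 1 ∈ J →
    g v = (Real.cosh (φ (v 0)) • f (v 1) + Real.sinh (φ (v 0)) • curveNormal f (v 1), χ (v 0))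

/-- The direction of the horizontal projection of the coordinate curves `y = const`. -/
noncomputable def crossDir (f : ℝ → Mink) (φ : ℝ → ℝ) (v : Plane) : Mink :=
  Real.sinh (φ (v 0)) • f (v 1) + Real.cosh (φ (v 0)) • curveNormal f (v 1)

theorem hasDerivAt_fderiv_line {E : Type*} [NormedAddCommGroup E] [NormedSpace ℝ E] {g : Plane → E}
    {g' : Plane →L[ℝ] E} {v : Plane} (hg : HasFDerivAt g g' v) (e : Plane) (t₀ : ℝ) :
    HasDerivAt (fun t : ℝ => g (v + (t - t₀) • e)) (g' e) t₀ := by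
  have h1 : HasDerivAt (fun t : ℝ => v + (t - t₀) • e) e t₀ := by
    simpa using (((hasDerivAt_id t₀).sub_const t₀).smul_const e).const_add v
  have h2 : HasFDerivAt g g' (v + (t₀ - t₀) • e) := by simpa using hg
  exact h2.comp_hasDerivAt t₀ h1

namespace IsCoordNormalForm

variable {g n : Plane → Amb} {I J : Set ℝ} {f : ℝ → Mink} {φ χ : ℝ → ℝ}
  (C : IsCoordNormalForm g I J f φ χ) (S : IsLocalSurface g n {v | v 0 ∈ I ∧ v 1 ∈ J})
include C S

theorem fderiv_single_zero {v : Plane} (h0 : v 0 ∈ I) (h1 : v 1 ∈ J) :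
    fderiv ℝ g v (EuclideanSpace.single 0 1) = (deriv φ (v 0) • crossDir f φ v, deriv χ (v 0)) := by
  have hl := hasDerivAt_fderiv_line (S.hasFDerivAt ⟨h0, h1⟩) (EuclideanSpace.single 0 1) (v 0)
  have hφ : HasDerivAt φ (deriv φ (v 0)) (v 0) :=
    ((C.smooth_φ.contDiffAt (C.isOpen_I.mem_nhds h0)).differentiableAt (by simp)).hasDerivAt
  have hχ : HasDerivAt χ (deriv χ (v 0)) (v 0) :=
    ((C.smooth_χ.contDiffAt (C.isOpen_I.mem_nhds h0)).differentiableAt (by simp)).hasDerivAt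
  have hr := ((hφ.cosh.smul_const (f (v 1))).add
    (hφ.sinh.smul_const (curveNormal f (v 1)))).prodMk hχ
  have he := hl.unique (hr.congr_of_eventuallyEq (by
    filter_upwards [C.isOpen_I.mem_nhds h0] with x hx
    rw [C.formula _ (by simpa using hx) (by simpa using h1)]
    simp))
  rw [he, crossDir]
  ext1
  · simp only [smul_add, smul_smul]
    congr 2 <;> ring
  · rfl

theorem exists_fderiv_single_one {v : Plane} (h0 : v 0 ∈ I) (h1 : v 1 ∈ J) :
    ∃ r : ℝ, r ≠ 0 ∧ fderiv ℝ g v (EuclideanSpace.single 1 1) = (r • deriv f (v 1), 0) := by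
  have hl := hasDerivAt_fderiv_line (S.hasFDerivAt ⟨h0, h1⟩) (EuclideanSpace.single 1 1) (v 1)
  have hfd := hasDerivAt_of_contDiffOn C.isOpen_J C.smooth_f h1
  obtain ⟨k, hk⟩ := exists_hasDerivAt_curveNormal C.isOpen_J C.smooth_f C.f_mem C.f_regular h1
  have hr := ((hfd.const_smul (Real.cosh (φ (v 0)))).add
    (hk.const_smul (Real.sinh (φ (v 0))))).prodMk (hasDerivAt_const (v 1) (χ (v 0)))
  have he := hl.unique (hr.congr_of_eventuallyEq (by
    filter_upwards [C.isOpen_J.mem_nhds h1] with x hx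
    rw [C.formula _ (by simpa using h0) (by simpa using hx)]
    simp))
  -- With `N_f' = k f'` the `y`-derivative is this multiple of `f'`; it cannot vanish because the
  -- surface is immersed.
  refine ⟨Real.cosh (φ (v 0)) + Real.sinh (φ (v 0)) * k, ?_, ?_⟩
  · intro hz
    rw [smul_smul, ← add_smul, hz, zero_smul] at he
    have h2 := S.immersion v ⟨h0, h1⟩ (he.trans (map_zero (fderiv ℝ g v)).symm)
    simpa using congrArg (fun w : Plane => w 1) h2
  · rw [he, smul_smul, ← add_smul]

omit S in
theorem crossDir_facts {v : Plane} (h0 : v 0 ∈ I) (h1 : v 1 ∈ J) :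
    lor (crossDir f φ v) (g v).1 = 0 ∧ lor (crossDir f φ v) (deriv f (v 1)) = 0 ∧
      lor (crossDir f φ v) (crossDir f φ v) = 1 ∧ lor (g v).1 (deriv f (v 1)) = 0 := by
  have a1 := (C.f_mem _ h1).1
  have a2 := lor_deriv_eq_zero C.isOpen_J C.smooth_f C.f_mem h1
  have a3 := lor_curveNormal_left f (v 1)
  have a4 := lor_curveNormal_deriv f (v 1)
  have a5 := lor_curveNormal_self C.isOpen_J C.smooth_f C.f_mem C.f_regular h1
  have a6 := a3
  rw [lor_comm] at a6
  have a7 := Real.cosh_sq (φ (v 0))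
  rw [C.formula v h0 h1, crossDir]
  simp only [lor_add_left, lor_add_right, lor_smul_left, lor_smul_right, a1, a2, a3, a4, a5, a6]
  refine ⟨by ring, by ring, by linear_combination a7, by ring⟩

theorem eq_smul_crossDir {v : Plane} (h0 : v 0 ∈ I) (h1 : v 1 ∈ J) {w : Mink}
    (hw : lor w (g v).1 = 0) (hw' : lor w (deriv f (v 1)) = 0) :
    w = lor w (crossDir f φ v) • crossDir f φ v := by
  obtain ⟨b1, b2, b3, b4⟩ := C.crossDir_facts h0 h1
  exact eq_lor_smul_of_orthogonal (S.mem v ⟨h0, h1⟩) (C.f_regular _ h1) b4 b1 b2 b3 hw hw'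

theorem lor_normal_deriv {v : Plane} (h0 : v 0 ∈ I) (h1 : v 1 ∈ J) :
    lor (n v).1 (deriv f (v 1)) = 0 := by
  obtain ⟨r, hr, hr'⟩ := C.exists_fderiv_single_one S h0 h1
  have h := S.normal v ⟨h0, h1⟩ (EuclideanSpace.single 1 1)
  rw [hr'] at h
  simp only [metric, lor_smul_left, zero_mul, add_zero] at h
  rw [lor_comm]
  exact (mul_eq_zero.1 h).resolve_left hr

/-- The unit normal is `(a E, c)`, with `(a, c)` a unit normal of the plane curve. -/
theorem exists_normal_eq {v : Plane} (h0 : v 0 ∈ I) (h1 : v 1 ∈ J) :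
    ∃ a : ℝ, (n v).1 = a • crossDir f φ v ∧ deriv φ (v 0) * a + deriv χ (v 0) * (n v).2 = 0 ∧
      a ^ 2 + (n v).2 ^ 2 = 1 := by
  have h := C.eq_smul_crossDir S h0 h1 (S.tangent v ⟨h0, h1⟩) (C.lor_normal_deriv S h0 h1)
  obtain ⟨b1, b2, b3, b4⟩ := C.crossDir_facts h0 h1
  have hn := S.normal v ⟨h0, h1⟩ (EuclideanSpace.single 0 1)
  have hu := S.unit v ⟨h0, h1⟩
  rw [C.fderiv_single_zero S h0 h1] at hn
  generalize lor (n v).1 (crossDir f φ v) = a at h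
  refine ⟨a, h, ?_, ?_⟩
  · simp only [metric, h, lor_smul_left, lor_smul_right, b3] at hn
    linarith
  · simp only [metric, h, lor_smul_left, lor_smul_right, b3] at hu
    linarith

/-- The vectors of the form `(r E, s)` orthogonal to the normal `(a E, c)` are the multiples of `(-c
E, a)`, the direction of the `x`-derivative. Both `∂ₜ - c n` and the projected `x`-derivative of `n`
are of this kind. -/
theorem isLocallyPrincipal {v : Plane} (h0 : v 0 ∈ I) (h1 : v 1 ∈ J) :
    IsLocallyPrincipal g n v := by
  obtain ⟨a, ha, hac, hac1⟩ := C.exists_normal_eq S h0 h1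
  obtain ⟨b1, b2, b3, b4⟩ := C.crossDir_facts h0 h1
  have hgx := C.fderiv_single_zero S h0 h1
  set E := crossDir f φ v
  set p := deriv φ (v 0)
  set q := deriv χ (v 0)
  set c := (n v).2 with hc
  set e : Plane := EuclideanSpace.single 0 1
  -- The velocity `(p, q)` is orthogonal to the unit vector `(a, c)`, hence is `l (-c, a)` with `l`
  -- its inner product with `(-c, a)`.
  obtain ⟨l, hl, hp, hq⟩ : ∃ l : ℝ, l ≠ 0 ∧ p = l * -c ∧ q = l * a := by
    refine ⟨-c * p + a * q, ?_, by linear_combination (-p) * hac1 + a * hac,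
      by linear_combination (-q) * hac1 + c * hac⟩
    intro hl
    have hp : p = 0 := by linear_combination (-p) * hac1 + a * hac - c * hl
    have hq : q = 0 := by linear_combination (-q) * hac1 + c * hac + a * hl
    exact (C.regular _ h0).elim (fun h => h hp) (fun h => h hq)
  have hd := S.hasFDerivAt_normal (v := v) ⟨h0, h1⟩
  -- On the line `y = const` the vector `f'(y)` is fixed, so `⟨n.1, f'⟩ = 0` can be differentiated
  -- without differentiating `f'`.
  have hdf : lor (fderiv ℝ n v e).1 (deriv f (v 1)) = 0 := by
    have := lor_deriv_add_eq_zero (hasDerivAt_fderiv_line hd.fst e (v 0))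
      (hasDerivAt_const (v 0) (deriv f (v 1))) (c := 0) (by
        filter_upwards [C.isOpen_I.mem_nhds h0] with x hx
        have := C.lor_normal_deriv S (v := v + (x - v 0) • e) (by simpa [e] using hx)
          (by simpa [e] using h1)
        simpa [e] using this)
    simpa [lor_zero_right] using this
  have hg1 := (S.mem v ⟨h0, h1⟩).1
  have hproj := C.eq_smul_crossDir S h0 h1 (w := (proj (g v) (fderiv ℝ n v e)).1)
    (by simp only [proj, lor_add_left, lor_smul_left, hg1]; ring)
    (by simp only [proj, lor_add_left, lor_smul_left, hdf, b4]; ring)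
  have hm := S.metric_fderiv_normal (v := v) ⟨h0, h1⟩ e
  have hlor : lor (proj (g v) (fderiv ℝ n v e)).1 E = lor (fderiv ℝ n v e).1 E := by
    rw [lor_comm] at b1
    simp only [proj, lor_add_left, lor_smul_left, b1]; ring
  have hproj2 : (proj (g v) (fderiv ℝ n v e)).2 = (fderiv ℝ n v e).2 := rfl
  simp only [metric, ha, lor_smul_right] at hm
  change _ = _ • E at hproj
  rw [hlor] at hproj
  generalize lor (fderiv ℝ n v e).1 E = β at hproj hm
  have hk : proj (g v) (fderiv ℝ n v e) = ((-c * β + a * (fderiv ℝ n v e).2) / l) •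
      fderiv ℝ g v e := by
    rw [hgx]
    generalize (fderiv ℝ n v e).2 = γ at hm hproj2
    ext1
    · rw [hproj, Prod.smul_fst, smul_smul, hp]
      congr 1
      field_simp
      linear_combination -β * hac1 + a * hm
    · rw [hproj2, Prod.smul_snd, hq, smul_eq_mul]
      field_simp
      linear_combination -γ * hac1 + c * hm
  -- As `1 - c ^ 2 = a ^ 2`, the vector `∂ₜ - c n` equals `a (-c E, a)`, which is `a / l` times the
  -- `x`-derivative.
  refine ⟨(a / l) • e, ?_, (-c * β + a * (fderiv ℝ n v e).2) / l, ?_⟩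
  · rw [map_smul, hgx]
    ext1
    · simp only [Prod.smul_fst, Prod.fst_sub, dt, ha, smul_smul, zero_sub, hp, ← neg_smul, ← hc]
      congr 1
      field_simp
    · simp only [Prod.smul_snd, Prod.snd_sub, dt, hq, smul_eq_mul, ← hc]
      field_simp
      linear_combination hac1
  · rw [map_smul, map_smul, smul_comm, ← hk]
    simp only [proj, Prod.smul_fst, Prod.smul_snd, lor_smul_left, smul_add, smul_smul,
      Prod.smul_mk]

omit C S in
theorem speed_pos {x : ℝ} (h : deriv φ x ≠ 0 ∨ deriv χ x ≠ 0) : 0 < speed φ χ x := by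
  refine Real.sqrt_pos.2 ?_
  rcases h with h | h
  · have := sq_pos_of_ne_zero h; positivity
  · have := sq_pos_of_ne_zero h; positivity

omit C S in
theorem isPreconnected_box (hI : I.OrdConnected) (hJ : J.OrdConnected) :
    IsPreconnected {v : Plane | v 0 ∈ I ∧ v 1 ∈ J} := by
  refine Convex.isPreconnected ?_
  intro v hv w hw a b ha hb hab
  exact ⟨by simpa using hI.convex hv.1 hw.1 ha hb hab, by simpa using hJ.convex hv.2 hw.2 ha hb hab⟩

/-- Up to signs, the angle function of the plane curve is the one of the surface. -/
theorem exists_signs (h0 : ∀ v : Plane, v 0 ∈ I → v 1 ∈ J → (n v).2 ≠ 0)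
    (h1 : ∀ v : Plane, v 0 ∈ I → v 1 ∈ J → (n v).2 ^ 2 ≠ 1) :
    ∃ ε δ : ℝ, (ε = 1 ∨ ε = -1) ∧ (δ = 1 ∨ δ = -1) ∧ ∀ v : Plane, v 0 ∈ I → v 1 ∈ J →
      δ * deriv φ (v 0) = speed φ χ (v 0) * (ε * (n v).2) ∧
      δ * deriv χ (v 0) = speed φ χ (v 0) * Real.sqrt (1 - (ε * (n v).2) ^ 2) := by
  set U := {v : Plane | v 0 ∈ I ∧ v 1 ∈ J}
  have hU : IsPreconnected U := isPreconnected_box C.interval_I C.interval_J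
  have hsq : ∀ v ∈ U, deriv φ (v 0) ^ 2 = (speed φ χ (v 0) * (n v).2) ^ 2 ∧
      deriv χ (v 0) ^ 2 = speed φ χ (v 0) ^ 2 * (1 - (n v).2 ^ 2) := by
    intro v hv
    obtain ⟨a, -, h2, h3⟩ := C.exists_normal_eq S hv.1 hv.2
    have hs : speed φ χ (v 0) ^ 2 = deriv φ (v 0) ^ 2 + deriv χ (v 0) ^ 2 :=
      Real.sq_sqrt (by positivity)
    constructor
    · rw [mul_pow, hs]
      linear_combination (deriv φ (v 0) * a - deriv χ (v 0) * (n v).2) * h2 -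
        deriv φ (v 0) ^ 2 * h3
    · rw [hs]
      linear_combination (deriv χ (v 0) * (n v).2 - deriv φ (v 0) * a) * h2 +
        deriv φ (v 0) ^ 2 * h3
  have hsp : ∀ v ∈ U, 0 < speed φ χ (v 0) := fun v hv => speed_pos (C.regular _ hv.1)
  have hle : ∀ v ∈ U, 0 < 1 - (n v).2 ^ 2 := by
    intro v hv
    obtain ⟨a, -, h2, h3⟩ := C.exists_normal_eq S hv.1 hv.2
    have := h1 v hv.1 hv.2
    have : a ^ 2 ≠ 0 := fun h => this (by linarith)
    have := lt_of_le_of_ne (sq_nonneg a) this.symm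
    linarith
  have hcont : ∀ {u : ℝ → ℝ}, ContDiffOn ℝ ∞ u I → ContinuousOn (fun v : Plane => deriv u (v 0)) U :=
    fun {u} hu => ((contDiffOn_infty_iff_deriv_of_isOpen C.isOpen_I).1 hu).2.continuousOn.comp
      (by fun_prop) fun v hv => hv.1
  have hφ0 : ∀ v ∈ U, deriv φ (v 0) ≠ 0 := by
    intro v hv h
    have := (hsq v hv).1
    rw [h] at this
    have h2 : speed φ χ (v 0) * (n v).2 ≠ 0 := mul_ne_zero (hsp v hv).ne' (h0 v hv.1 hv.2)
    exact h2 (by simpa using this.symm)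
  have hχ0 : ∀ v ∈ U, deriv χ (v 0) ≠ 0 := by
    intro v hv h
    have := (hsq v hv).2
    rw [h] at this
    have h2 := mul_pos (pow_pos (hsp v hv) 2) (hle v hv)
    simp at this
    rcases this with h | h
    · exact (hsp v hv).ne' h
    · exact (hle v hv).ne' h
  -- The sine of an angle in `(0, π)` is positive, so `δ` must be the sign of `χ'`. With `τ` the
  -- sign of `φ' c`, the cosine then forces `ε = δ τ`.
  obtain ⟨δ, hδ, hδ'⟩ := exists_sign_of_ne_zero hU (hcont C.smooth_χ) hχ0
  obtain ⟨τ, hτ, hτ'⟩ := exists_sign_of_ne_zero hU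
    ((hcont C.smooth_φ).mul S.smooth_normal.continuousOn.snd)
    (fun v hv => mul_ne_zero (hφ0 v hv) (h0 v hv.1 hv.2))
  have hδ2 : δ ^ 2 = 1 := by rcases hδ with h | h <;> simp [h]
  have hτ2 : τ ^ 2 = 1 := by rcases hτ with h | h <;> simp [h]
  refine ⟨δ * τ, δ, ?_, hδ, ?_⟩
  · rcases hδ with h | h <;> rcases hτ with h' | h' <;> simp [h, h']
  · intro v h0v h1v
    have hv : v ∈ U := ⟨h0v, h1v⟩
    obtain ⟨e1, e2⟩ := hsq v hv
    constructor
    · have hp : 0 < τ * (deriv φ (v 0) * (n v).2) := hτ' v hv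
      rcases sq_eq_sq_iff_eq_or_eq_neg.1 e1 with h | h
      · have : τ = 1 := by
          rcases hτ with ht | ht
          · exact ht
          · exfalso
            rw [ht, h] at hp
            nlinarith [hsp v hv, mul_nonneg (hsp v hv).le (sq_nonneg (n v).2)]
        rw [h, this]; ring
      · have : τ = -1 := by
          rcases hτ with ht | ht
          · exfalso
            rw [ht, h] at hp
            nlinarith [hsp v hv, mul_nonneg (hsp v hv).le (sq_nonneg (n v).2)]
          · exact ht
        rw [h, this]; ring
    · have h2 : (δ * τ * (n v).2) ^ 2 = (n v).2 ^ 2 := by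
        rw [mul_pow, mul_pow, hδ2, hτ2]; ring
      rw [h2]
      have h3 : (δ * deriv χ (v 0)) ^ 2 = (speed φ χ (v 0) * Real.sqrt (1 - (n v).2 ^ 2)) ^ 2 := by
        rw [mul_pow, mul_pow, hδ2, Real.sq_sqrt (hle v hv).le, one_mul, e2]
      exact (sq_eq_sq₀ (hδ' v hv).le (mul_nonneg (hsp v hv).le (Real.sqrt_nonneg _))).1 h3

end IsCoordNormalForm

/-! ### Surfaces on which the projection of `∂ₜ` is principal -/

/-- Every parameter in `K i` is attained, so facts proved at points of the surface pass to facts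
about functions of one coordinate. -/
theorem IsBoxChart.exists_apply_eq {κ : OpenPartialHomeomorph Plane Plane} {K : Fin 2 → Set ℝ}
    (hκ : IsBoxChart κ K) {v₀ : Plane} (hv₀ : v₀ ∈ κ.source) {i : Fin 2} {x : ℝ} (hx : x ∈ K i) :
    ∃ v ∈ κ.source, κ v i = x := by
  have h0 := κ.map_source hv₀
  rw [hκ.target] at h0
  have hw : WithLp.toLp 2 (Function.update (κ v₀) i x) ∈ κ.target := by
    rw [hκ.target]
    intro j
    by_cases hj : j = i
    · subst hj; simpa using hx
    · simpa [hj] using h0 j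
  refine ⟨_, κ.map_target hw, ?_⟩
  rw [κ.right_inv hw]
  simp

theorem exists_ne_zero_apply_eq_zero (l : Plane →L[ℝ] ℝ) : ∃ Y ≠ 0, l Y = 0 := by
  by_cases h : l (EuclideanSpace.single 0 1) = 0
  · exact ⟨_, by simp, h⟩
  · refine ⟨l (EuclideanSpace.single 1 1) • EuclideanSpace.single 0 1 -
      l (EuclideanSpace.single 0 1) • EuclideanSpace.single 1 1, fun h0 => h ?_, ?_⟩
    · simpa using congrArg (fun w : Plane => w 1) h0
    · simp only [map_sub, map_smul, smul_eq_mul]; ring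

/-- A unit vector orthogonal to `f` and `f'` and on the right side is the normal of the curve. -/
theorem eq_curveNormal {f : ℝ → Mink} {y : ℝ} {q : Mink} (hf : f y ∈ hyp) (hf' : deriv f y ≠ 0)
    (hff' : lor (f y) (deriv f y) = 0) (hq : lor q q = 1) (hqf : lor q (f y) = 0)
    (hqf' : lor q (deriv f y) = 0) (hpos : 0 < lor q (lorCross (f y) (deriv f y))) :
    q = curveNormal f y := by
  have hp := lor_self_pos hf hf' hff'
  have h1 := lorCross_parallel hqf hqf'
  have h2 : lor (lorCross (f y) (deriv f y)) (lorCross (f y) (deriv f y)) =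
      lor (deriv f y) (deriv f y) := by
    rw [lor_lorCross_self, hff', hf.1]; ring
  rw [h2] at h1
  have h3 : lor q (lorCross (f y) (deriv f y)) = Real.sqrt (lor (deriv f y) (deriv f y)) := by
    have := congrArg (lor q) h1
    rw [lor_smul_right, lor_smul_right, hq, mul_one] at this
    rw [this, Real.sqrt_mul_self hpos.le]
  have hs := Real.sqrt_pos.2 hp
  have hss := Real.mul_self_sqrt hp.le
  rw [curveNormal, ← one_smul ℝ q, ← inv_mul_cancel₀ hp.ne', mul_smul, h1, h3, smul_smul]
  congr 1
  rw [inv_mul_eq_iff_eq_mul₀ hp.ne', ← div_eq_mul_inv, eq_div_iff hs.ne', hss]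

namespace IsLocalSurface

variable {g n : Plane → Amb} {U : Set Plane} (S : IsLocalSurface g n U)
include S

theorem hasFDerivAt_height {v : Plane} (hv : v ∈ U) : HasFDerivAt (fun w => (g w).2)
    ((ContinuousLinearMap.snd ℝ Mink ℝ).comp (fderiv ℝ g v)) v := (S.hasFDerivAt hv).snd

theorem fderiv_height {v : Plane} (hv : v ∈ U) (X : Plane) :
    fderiv ℝ (fun w => (g w).2) v X = (fderiv ℝ g v X).2 := by
  rw [(S.hasFDerivAt_height hv).fderiv]; rfl

theorem lor_normal_self {v : Plane} (hv : v ∈ U) :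
    lor (n v).1 (n v).1 = 1 - (n v).2 ^ 2 := by
  have := S.unit v hv
  unfold metric at this
  linarith

theorem one_sub_sq_pos {v : Plane} (hv : v ∈ U) (h : (n v).2 ^ 2 ≠ 1) : 0 < 1 - (n v).2 ^ 2 := by
  have h1 := lor_self_nonneg (S.mem v hv) (by rw [lor_comm]; exact S.tangent v hv)
  rw [S.lor_normal_self hv] at h1
  exact lt_of_le_of_ne h1 fun h2 => h (by linarith)

/-- The second fundamental form is symmetric. -/
theorem metric_fderiv_normal_symm {v : Plane} (hv : v ∈ U) (X Y : Plane) :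
    metric (fderiv ℝ n v Y) (fderiv ℝ g v X) = metric (fderiv ℝ n v X) (fderiv ℝ g v Y) := by
  have hg := S.smooth.contDiffAt (S.mem_nhds hv)
  have hd : HasFDerivAt (fderiv ℝ g) (fderiv ℝ (fderiv ℝ g) v) v :=
    ((hg.fderiv_right (m := 1) (by norm_cast)).differentiableAt (by simp)).hasFDerivAt
  have key : ∀ X Y, metric (fderiv ℝ n v Y) (fderiv ℝ g v X) +
      metric (n v) (fderiv ℝ (fderiv ℝ g) v Y X) = 0 := by
    intro X Y
    have hX : HasFDerivAt (fun w => fderiv ℝ g w X)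
        ((ContinuousLinearMap.apply ℝ Amb X).comp (fderiv ℝ (fderiv ℝ g) v)) v :=
      (ContinuousLinearMap.apply ℝ Amb X).hasFDerivAt.comp v hd
    exact metric_fderiv_add_eq_zero (S.hasFDerivAt_normal hv) hX (c := 0)
      (by filter_upwards [S.mem_nhds hv] with w hw
          rw [metric_comm]; exact S.normal w hw X) Y
  have h1 := key X Y
  have h2 := key Y X
  have hs : fderiv ℝ (fderiv ℝ g) v Y X = fderiv ℝ (fderiv ℝ g) v X Y :=
    hg.isSymmSndFDerivAt (by simp only [minSmoothness_of_isRCLikeNormedField]; norm_cast) Y X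
  rw [hs] at h1
  linarith

/-- Where the projection of `∂ₜ` is principal, the differential of the angle function is a multiple
of that of the height. -/
theorem fderiv_normal_snd {v : Plane} (hv : v ∈ U) {X : Plane} {k : ℝ}
    (hX : fderiv ℝ g v X = dt - (n v).2 • n v)
    (hk : proj (g v) (fderiv ℝ n v X) = k • fderiv ℝ g v X) (Y : Plane) :
    (fderiv ℝ n v Y).2 = k * (fderiv ℝ g v Y).2 := by
  have hsym := S.metric_fderiv_normal_symm hv X Y
  -- Since `dn(Y)` is orthogonal to `n`, pairing it with `∂ₜ - c n` is the same as pairing it with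
  -- `∂ₜ`; likewise for `dg(Y)` below.
  have h1 : metric (fderiv ℝ n v Y) (fderiv ℝ g v X) = (fderiv ℝ n v Y).2 := by
    have := S.metric_fderiv_normal hv Y
    rw [hX]
    simp only [metric, dt, Prod.fst_sub, Prod.snd_sub, Prod.smul_fst, Prod.smul_snd, lor_sub_right,
      lor_smul_right, lor_zero_right, smul_eq_mul] at this ⊢
    linear_combination (-(n v).2) * this
  have h2 : metric (fderiv ℝ g v X) (fderiv ℝ g v Y) = (fderiv ℝ g v Y).2 := by
    have := S.normal v hv Y
    rw [metric_comm] at this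
    rw [hX]
    simp only [metric, dt, Prod.fst_sub, Prod.snd_sub, Prod.smul_fst, Prod.smul_snd, lor_sub_left,
      lor_smul_left, lor_zero_left, smul_eq_mul] at this ⊢
    linear_combination (-(n v).2) * this
  have h3 : metric (fderiv ℝ n v X) (fderiv ℝ g v Y) =
      metric (proj (g v) (fderiv ℝ n v X)) (fderiv ℝ g v Y) := by
    have := S.lor_fderiv hv Y
    rw [lor_comm] at this
    simp only [metric, proj, lor_add_left, lor_smul_left, this]
    ring
  have h4 : metric (k • fderiv ℝ g v X) (fderiv ℝ g v Y) =
      k * metric (fderiv ℝ g v X) (fderiv ℝ g v Y) := by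
    simp only [metric, Prod.smul_fst, Prod.smul_snd, lor_smul_left, smul_eq_mul]
    ring
  rw [← h1, hsym, h3, hk, h4, h2]

omit S in
theorem height_fderiv_of_principal {v : Plane} {X : Plane}
    (hX : fderiv ℝ g v X = dt - (n v).2 • n v) : (fderiv ℝ g v X).2 = 1 - (n v).2 ^ 2 := by
  rw [hX]
  simp only [dt, Prod.snd_sub, Prod.smul_snd, smul_eq_mul]
  ring

variable (hne : ∀ v ∈ U, (n v).2 ^ 2 ≠ 1) (hP : ∀ v ∈ U, IsLocallyPrincipal g n v)
include hne hP

/-- Near a point, the angle is a function of the height, and so is a primitive of its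
cotangent. -/
theorem exists_primitive {v₀ : Plane} (hv₀ : v₀ ∈ U) :
    ∃ (U' : Set Plane) (I : Set ℝ) (ψ : ℝ → ℝ), IsOpen U' ∧ U' ⊆ U ∧ v₀ ∈ U' ∧ IsOpen I ∧
      ContDiffOn ℝ ∞ ψ I ∧ ψ (g v₀).2 = 0 ∧ ∀ v ∈ U', (g v).2 ∈ I ∧
        HasDerivAt ψ ((n v).2 / Real.sqrt (1 - (n v).2 ^ 2)) (g v).2 := by
  obtain ⟨X, hX, k, hk⟩ := hP v₀ hv₀
  have hX2 := height_fderiv_of_principal hX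
  have hpos := S.one_sub_sq_pos hv₀ (hne v₀ hv₀)
  have hX0 : X ≠ 0 := by
    rintro rfl
    rw [map_zero] at hX2
    exact hpos.ne hX2
  -- An auxiliary second coordinate: a linear form that vanishes on `X` and takes the value `X 0 ^ 2
  -- + X 1 ^ 2` on the rotated vector.
  let l : Plane →L[ℝ] ℝ := X 1 • (EuclideanSpace.proj 0 : Plane →L[ℝ] ℝ) -
    X 0 • (EuclideanSpace.proj 1 : Plane →L[ℝ] ℝ)
  have hl : ∀ w, l w = X 1 * w 0 - X 0 * w 1 := fun w => by simp [l]
  have hlX : fderiv ℝ l v₀ X = 0 := by rw [l.fderiv, hl]; ring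
  have hlY : fderiv ℝ l v₀ (!₂[X 1, -X 0]) ≠ 0 := by
    rw [l.fderiv, hl]
    intro h
    simp only [Matrix.cons_val_zero, Matrix.cons_val_one] at h
    refine hX0 (plane_ext ?_ ?_) <;> simp <;> nlinarith [sq_nonneg (X 0), sq_nonneg (X 1)]
  obtain ⟨κ, K, hκ, hκ₀, hκU, hκc⟩ := exists_isBoxChart S.isOpen
    (a := fun w => (g w).2) (b := l) S.smooth.snd l.contDiff.contDiffOn hv₀ (X := X)
    (by rw [S.fderiv_height hv₀, hX2]; exact hpos.ne') hlX hlY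
  have hκ0 : ∀ v ∈ κ.source, κ v 0 = (g v).2 := fun v hv => (hκc v hv).1
  obtain ⟨C, hC, hC'⟩ := hκ.exists_eq_comp (g := fun w => (n w).2)
    (S.smooth_normal.snd.mono hκU) 0 (by
      intro v hv
      obtain ⟨Y, hY0, hY⟩ := exists_ne_zero_apply_eq_zero (fderiv ℝ (fun w => κ w 0) v)
      refine ⟨Y, hY0, hY, ?_⟩
      have he : (fun w => κ w 0) =ᶠ[nhds v] fun w => (g w).2 := by
        filter_upwards [κ.open_source.mem_nhds hv] with w hw using hκ0 w hw
      rw [he.fderiv_eq, S.fderiv_height (hκU hv)] at hY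
      obtain ⟨X', hX', k', hk'⟩ := hP v (hκU hv)
      have h3 : fderiv ℝ (fun w => (n w).2) v Y = (fderiv ℝ n v Y).2 := by
        rw [(S.hasFDerivAt_normal (hκU hv)).snd.fderiv]; rfl
      rw [h3, S.fderiv_normal_snd (hκU hv) hX' hk', hY, mul_zero]) hκ₀
  have hCp : ∀ x ∈ K 0, 0 < 1 - C x ^ 2 := by
    intro x hx
    obtain ⟨v, hv, rfl⟩ := hκ.exists_apply_eq hκ₀ hx
    rw [← hC' v hv]
    exact S.one_sub_sq_pos (hκU hv) (hne v (hκU hv))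
  have hK : ∀ v ∈ κ.source, (g v).2 ∈ K 0 := by
    intro v hv
    have := κ.map_source hv
    rw [hκ.target] at this
    rw [← hκ0 v hv]
    exact this 0
  -- With `C` the cosine of the angle as a function of the height, the integrand is `cot θ`.
  obtain ⟨ψ, hψ0, hψ, hψd⟩ := exists_antiderivative (hκ.isOpen 0) (hκ.interval 0)
    (g := fun x => C x / Real.sqrt (1 - C x ^ 2))
    (hC.div ((contDiffOn_const.sub (hC.pow 2)).sqrt fun x hx => (hCp x hx).ne')
      fun x hx => (Real.sqrt_pos.2 (hCp x hx)).ne') (hK v₀ hκ₀)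
  refine ⟨κ.source, K 0, ψ, κ.open_source, hκU, hκ₀, hκ.isOpen 0, hψ, hψ0, fun v hv => ⟨hK v hv, ?_⟩⟩
  have := hψd _ (hK v hv)
  rwa [← hκ0 v hv, ← hC' v hv, hκ0 v hv] at this

end IsLocalSurface

/-! ### The horizontal unit direction and its derivatives -/

/-- The unit vector opposite to the horizontal part of the normal. -/
noncomputable def horDir (n : Plane → Amb) (v : Plane) : Mink :=
  (-(Real.sqrt (1 - (n v).2 ^ 2))⁻¹) • (n v).1

namespace IsLocalSurface

variable {g n : Plane → Amb} {U : Set Plane} (S : IsLocalSurface g n U)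
  (hne : ∀ v ∈ U, (n v).2 ^ 2 ≠ 1)
include S hne

theorem contDiffOn_horDir_factor :
    ContDiffOn ℝ ∞ (fun v => -(Real.sqrt (1 - (n v).2 ^ 2))⁻¹) U := by
  have h1 : ContDiffOn ℝ ∞ (fun v => 1 - (n v).2 ^ 2) U :=
    contDiffOn_const.sub (S.smooth_normal.snd.pow 2)
  have hp : ∀ v ∈ U, 0 < 1 - (n v).2 ^ 2 := fun v hv => S.one_sub_sq_pos hv (hne v hv)
  exact ((h1.sqrt fun v hv => (hp v hv).ne').inv
    fun v hv => (Real.sqrt_pos.2 (hp v hv)).ne').neg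

theorem contDiffOn_horDir : ContDiffOn ℝ ∞ (horDir n) U :=
  (S.contDiffOn_horDir_factor hne).smul S.smooth_normal.fst

theorem hasFDerivAt_horDir {v : Plane} (hv : v ∈ U) :
    HasFDerivAt (horDir n) (fderiv ℝ (horDir n) v) v :=
  (((S.contDiffOn_horDir hne).contDiffAt (S.mem_nhds hv)).differentiableAt (by simp)).hasFDerivAt

theorem normal_fst_eq {v : Plane} (hv : v ∈ U) :
    (n v).1 = (-Real.sqrt (1 - (n v).2 ^ 2)) • horDir n v := by
  have := Real.sqrt_pos.2 (S.one_sub_sq_pos hv (hne v hv))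
  rw [horDir, smul_smul, neg_mul_neg, mul_inv_cancel₀ this.ne', one_smul]

omit hne in
theorem lor_horDir {v : Plane} (hv : v ∈ U) : lor (horDir n v) (g v).1 = 0 := by
  rw [horDir, lor_smul_left, S.tangent v hv, mul_zero]

theorem lor_horDir_self {v : Plane} (hv : v ∈ U) : lor (horDir n v) (horDir n v) = 1 := by
  have hp := S.one_sub_sq_pos hv (hne v hv)
  rw [horDir, lor_smul_left, lor_smul_right, S.lor_normal_self hv, ← mul_assoc, neg_mul_neg,
    ← mul_inv, Real.mul_self_sqrt hp.le, inv_mul_cancel₀ hp.ne']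

theorem lor_fderiv_horDir_self {v : Plane} (hv : v ∈ U) (Z : Plane) :
    lor (fderiv ℝ (horDir n) v Z) (horDir n v) = 0 := by
  have h := lor_fderiv_add_eq_zero (S.hasFDerivAt_horDir hne hv) (S.hasFDerivAt_horDir hne hv)
    (c := 1) (by filter_upwards [S.mem_nhds hv] with w hw using S.lor_horDir_self hne hw) Z
  rw [lor_comm (horDir n v)] at h
  linarith

/-- The derivative of the height, as a horizontal component. -/
theorem lor_horDir_fderiv {v : Plane} (hv : v ∈ U) (Z : Plane) :
    lor (horDir n v) (fderiv ℝ g v Z).1 =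
      (n v).2 / Real.sqrt (1 - (n v).2 ^ 2) * (fderiv ℝ g v Z).2 := by
  have h := S.normal v hv Z
  have := Real.sqrt_pos.2 (S.one_sub_sq_pos hv (hne v hv))
  rw [metric, lor_comm] at h
  rw [horDir, lor_smul_left]
  field_simp
  linear_combination -h

theorem lor_fderiv_horDir {v : Plane} (hv : v ∈ U) (Z : Plane) :
    lor (fderiv ℝ (horDir n) v Z) (g v).1 =
      -((n v).2 / Real.sqrt (1 - (n v).2 ^ 2) * (fderiv ℝ g v Z).2) := by
  have h := lor_fderiv_add_eq_zero (S.hasFDerivAt_horDir hne hv) (S.hasFDerivAt hv).fst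
    (c := 0) (by filter_upwards [S.mem_nhds hv] with w hw using S.lor_horDir hw) Z
  rw [← S.lor_horDir_fderiv hne hv]
  exact eq_neg_of_add_eq_zero_left h

theorem fderiv_fst_of_principal {v : Plane} (hv : v ∈ U) {X : Plane}
    (hX : fderiv ℝ g v X = dt - (n v).2 • n v) :
    (fderiv ℝ g v X).1 = ((n v).2 * Real.sqrt (1 - (n v).2 ^ 2)) • horDir n v := by
  rw [hX]
  simp only [dt, Prod.fst_sub, Prod.smul_fst, zero_sub]
  rw [S.normal_fst_eq hne hv, smul_smul, ← neg_smul]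
  congr 1
  ring

/-- Together with `fderiv_fst_of_principal`, this is the geodesic equation: along `T` the pair `(g₁,
E)` undergoes an infinitesimal hyperbolic rotation in its own plane. -/
theorem fderiv_horDir_of_principal {v : Plane} (hv : v ∈ U) {X : Plane} {k : ℝ}
    (hX : fderiv ℝ g v X = dt - (n v).2 • n v)
    (hk : proj (g v) (fderiv ℝ n v X) = k • fderiv ℝ g v X) :
    fderiv ℝ (horDir n) v X = ((n v).2 * Real.sqrt (1 - (n v).2 ^ 2)) • (g v).1 := by
  have hr : HasFDerivAt (fun v => -(Real.sqrt (1 - (n v).2 ^ 2))⁻¹) _ v :=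
    (((S.contDiffOn_horDir_factor hne).contDiffAt (S.mem_nhds hv)).differentiableAt
      (by simp)).hasFDerivAt
  have hE := (hr.smul (S.hasFDerivAt_normal hv).fst).fderiv
  have hp := S.one_sub_sq_pos hv (hne v hv)
  have h1 : (fderiv ℝ n v X).1 = k • (fderiv ℝ g v X).1 -
      lor (fderiv ℝ n v X).1 (g v).1 • (g v).1 := by
    rw [eq_sub_iff_add_eq]
    exact congrArg Prod.fst hk
  -- Principality is needed only to place `dE(X)` in the span of `E` and `g₁`; the derivative of the
  -- scalar factor is never computed. The coefficients follow by pairing with `E` and `g₁`.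
  obtain ⟨α, β, hαβ⟩ : ∃ α β : ℝ,
      fderiv ℝ (horDir n) v X = α • horDir n v + β • (g v).1 := by
    have h2 := congrArg (fun l : Plane →L[ℝ] Mink => l X) hE
    change fderiv ℝ (horDir n) v X = _ at h2
    simp only [add_apply, smul_apply,
      ContinuousLinearMap.comp_apply, ContinuousLinearMap.coe_fst',
      ContinuousLinearMap.smulRight_apply] at h2
    rw [h1, S.fderiv_fst_of_principal hne hv hX, S.normal_fst_eq hne hv] at h2
    generalize fderiv ℝ (fun v => -(Real.sqrt (1 - (n v).2 ^ 2))⁻¹) v X = δ at h2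
    generalize lor (fderiv ℝ n v X).1 (g v).1 = γ at h2
    generalize Real.sqrt (1 - (n v).2 ^ 2) = s at h2
    refine ⟨-s⁻¹ * (k * ((n v).2 * s)) + δ * -s, -s⁻¹ * -γ, ?_⟩
    rw [h2]
    module
  have h2 := S.lor_fderiv_horDir_self hne hv X
  have h3 := S.lor_fderiv_horDir hne hv X
  have h4 := S.lor_horDir hv
  have h5 := h4
  rw [lor_comm] at h5
  rw [hαβ] at h2 h3 ⊢
  rw [height_fderiv_of_principal hX] at h3
  simp only [lor_add_left, lor_smul_left, h4, h5, S.lor_horDir_self hne hv, (S.mem v hv).1] at h2 h3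
  have hα : α = 0 := by linarith
  have hs := Real.sqrt_pos.2 hp
  have hβ : β = (n v).2 * Real.sqrt (1 - (n v).2 ^ 2) := by
    have hss := Real.mul_self_sqrt hp.le
    have h6 : (n v).2 / Real.sqrt (1 - (n v).2 ^ 2) * (1 - (n v).2 ^ 2) =
        (n v).2 * Real.sqrt (1 - (n v).2 ^ 2) := by
      rw [div_mul_eq_mul_div, div_eq_iff hs.ne', mul_assoc, hss]
    linarith
  rw [hα, hβ, zero_smul, zero_add]

end IsLocalSurface

/-! ### The base curve traced by the feet of the geodesics -/

/-- The foot on the base curve of the geodesic of `ℍ²` through `g(v)` in the direction of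
`horDir n v`, at the distance `φ v`. -/
noncomputable def foot (g n : Plane → Amb) (φ : Plane → ℝ) (v : Plane) : Mink :=
  Real.cosh (φ v) • (g v).1 - Real.sinh (φ v) • horDir n v

/-- The direction of the same geodesic at the foot. -/
noncomputable def footDir (g n : Plane → Amb) (φ : Plane → ℝ) (v : Plane) : Mink :=
  Real.cosh (φ v) • horDir n v - Real.sinh (φ v) • (g v).1

theorem fst_eq_foot (g n : Plane → Amb) (φ : Plane → ℝ) (v : Plane) :
    (g v).1 = Real.cosh (φ v) • foot g n φ v + Real.sinh (φ v) • footDir g n φ v := by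
  have h : (g v).1 = (Real.cosh (φ v) ^ 2 - Real.sinh (φ v) ^ 2) • (g v).1 := by
    rw [Real.cosh_sq_sub_sinh_sq, one_smul]
  rw [foot, footDir]
  conv_lhs => rw [h]
  module

namespace IsLocalSurface

variable {g n : Plane → Amb} {U : Set Plane} (S : IsLocalSurface g n U)
  (hne : ∀ v ∈ U, (n v).2 ^ 2 ≠ 1) {φ : Plane → ℝ} (hφ : ContDiffOn ℝ ∞ φ U)
include S hne

-- In the tangent plane `E` spans the same line as `u ⊠ a`, where `u = (g v).1`; were the product
-- zero, `lorCross_parallel` would make the spacelike vector `u ⊠ a` null.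
omit hne in
theorem lor_lorCross_ne_zero {v : Plane} (hv : v ∈ U) {a : Mink} (ha : a ≠ 0) (hag : lor (g v).1 a = 0)
    {E : Mink} (hE : lor E E = 1) (hEg : lor E (g v).1 = 0) (hEa : lor E a = 0) :
    lor E (lorCross (g v).1 a) ≠ 0 := by
  intro h0
  have h := lorCross_parallel hEg hEa
  have hp := lor_self_pos (S.mem v hv) ha hag
  have h2 := congrArg (lor E) h
  rw [h0, zero_smul, lor_zero_right, lor_smul_right, hE, mul_one, lor_lorCross_self, hag,
    (S.mem v hv).1] at h2
  linarith

theorem lor_foot {v : Plane} (hv : v ∈ U) : lor (foot g n φ v) (foot g n φ v) = -1 ∧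
    lor (footDir g n φ v) (footDir g n φ v) = 1 ∧ lor (footDir g n φ v) (foot g n φ v) = 0 ∧
    foot g n φ v ∈ hyp := by
  have h1 := S.lor_horDir (n := n) hv
  have h2 := h1
  rw [lor_comm] at h2
  have h3 := S.lor_horDir_self hne hv
  have h4 := (S.mem v hv).1
  have h5 := Real.cosh_sq (φ v)
  have h6 : lor (foot g n φ v) (foot g n φ v) = -1 := by
    simp only [foot, lor_sub_left, lor_sub_right, lor_smul_left, lor_smul_right, h1, h2, h3, h4]
    linear_combination -h5
  refine ⟨h6, ?_, ?_, mem_hyp_of_lor_neg (S.mem v hv) h6 ?_⟩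
  · simp only [footDir, lor_sub_left, lor_sub_right, lor_smul_left, lor_smul_right, h1, h2, h3, h4]
    linear_combination h5
  · simp only [foot, footDir, lor_sub_left, lor_sub_right, lor_smul_left, lor_smul_right, h1, h2,
      h3, h4]
    ring
  · simp only [foot, lor_sub_left, lor_smul_left, h1, h4]
    linarith [Real.cosh_pos (φ v)]

include hφ

theorem contDiffOn_foot : ContDiffOn ℝ ∞ (foot g n φ) U :=
  ((Real.contDiff_cosh.comp_contDiffOn hφ).smul S.smooth.fst).sub
    ((Real.contDiff_sinh.comp_contDiffOn hφ).smul (S.contDiffOn_horDir hne))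

theorem contDiffOn_footDir : ContDiffOn ℝ ∞ (footDir g n φ) U :=
  ((Real.contDiff_cosh.comp_contDiffOn hφ).smul (S.contDiffOn_horDir hne)).sub
    ((Real.contDiff_sinh.comp_contDiffOn hφ).smul S.smooth.fst)

theorem fderiv_foot {v : Plane} (hv : v ∈ U) (Z : Plane) : fderiv ℝ (foot g n φ) v Z =
    Real.cosh (φ v) • (fderiv ℝ g v Z).1 - Real.sinh (φ v) • fderiv ℝ (horDir n) v Z -
      fderiv ℝ φ v Z • footDir g n φ v := by
  have hφd : HasFDerivAt φ (fderiv ℝ φ v) v :=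
    ((hφ.contDiffAt (S.mem_nhds hv)).differentiableAt (by simp)).hasFDerivAt
  have h := ((hφd.cosh.smul (S.hasFDerivAt hv).fst).sub
    (hφd.sinh.smul (S.hasFDerivAt_horDir hne hv))).fderiv
  have h2 := congrArg (fun l : Plane →L[ℝ] Mink => l Z) h
  change fderiv ℝ (foot g n φ) v Z = _ at h2
  rw [h2, footDir]
  simp only [sub_apply, add_apply, smul_apply, ContinuousLinearMap.comp_apply,
    ContinuousLinearMap.coe_fst', ContinuousLinearMap.smulRight_apply, smul_eq_mul]
  module

theorem fderiv_footDir {v : Plane} (hv : v ∈ U) (Z : Plane) : fderiv ℝ (footDir g n φ) v Z =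
    Real.cosh (φ v) • fderiv ℝ (horDir n) v Z - Real.sinh (φ v) • (fderiv ℝ g v Z).1 -
      fderiv ℝ φ v Z • foot g n φ v := by
  have hφd : HasFDerivAt φ (fderiv ℝ φ v) v :=
    ((hφ.contDiffAt (S.mem_nhds hv)).differentiableAt (by simp)).hasFDerivAt
  have h := ((hφd.cosh.smul (S.hasFDerivAt_horDir hne hv)).sub
    (hφd.sinh.smul (S.hasFDerivAt hv).fst)).fderiv
  have h2 := congrArg (fun l : Plane →L[ℝ] Mink => l Z) h
  change fderiv ℝ (footDir g n φ) v Z = _ at h2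
  rw [h2, foot]
  simp only [sub_apply, add_apply, smul_apply, ContinuousLinearMap.comp_apply,
    ContinuousLinearMap.coe_fst', ContinuousLinearMap.smulRight_apply, smul_eq_mul]
  module

variable (hφd : ∀ v ∈ U, ∀ Z, fderiv ℝ φ v Z =
  (n v).2 / Real.sqrt (1 - (n v).2 ^ 2) * (fderiv ℝ g v Z).2)
include hφd

/-- A Gauss lemma. Orthogonality of `n` to the surface gives `⟨dg₁, E⟩ = cot θ dh = -⟨dE, g₁⟩`, so
the hyperbolic functions combine to `cosh² - sinh² = 1` and leave `cot θ dh - dφ = 0`. Principality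
enters only through the existence of such a `φ`. -/
theorem lor_fderiv_foot {v : Plane} (hv : v ∈ U) (Z : Plane) :
    lor (fderiv ℝ (foot g n φ) v Z) (footDir g n φ v) = 0 := by
  have h1 := S.lor_horDir_fderiv hne hv Z
  rw [lor_comm] at h1
  have h2 := S.lor_fderiv hv Z
  have h3 := S.lor_fderiv_horDir_self hne hv Z
  have h4 := S.lor_fderiv_horDir hne hv Z
  obtain ⟨-, h5, -, -⟩ := S.lor_foot (φ := φ) hne hv
  rw [S.fderiv_foot hne hφ hv, hφd v hv]
  rw [lor_sub_left, lor_smul_left, h5, lor_sub_left, footDir]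
  simp only [lor_sub_right, lor_smul_left, lor_smul_right, h1, h2, h3, h4]
  linear_combination ((n v).2 / Real.sqrt (1 - (n v).2 ^ 2) * (fderiv ℝ g v Z).2) *
    Real.cosh_sq (φ v)

/-- The rotation of `(g₁, E)` along `T` has rate `cos θ sin θ = cot θ · sin² θ = dφ(T)`, exactly
what the rotation by `-φ` undoes. -/
theorem fderiv_foot_of_principal {v : Plane} (hv : v ∈ U) {X : Plane} {k : ℝ}
    (hX : fderiv ℝ g v X = dt - (n v).2 • n v)
    (hk : proj (g v) (fderiv ℝ n v X) = k • fderiv ℝ g v X) :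
    fderiv ℝ (foot g n φ) v X = 0 ∧ fderiv ℝ (footDir g n φ) v X = 0 := by
  have hp := S.one_sub_sq_pos hv (hne v hv)
  have hs := Real.sqrt_pos.2 hp
  have h6 : (n v).2 / Real.sqrt (1 - (n v).2 ^ 2) * (1 - (n v).2 ^ 2) =
      (n v).2 * Real.sqrt (1 - (n v).2 ^ 2) := by
    rw [div_mul_eq_mul_div, div_eq_iff hs.ne', mul_assoc, Real.mul_self_sqrt hp.le]
  rw [S.fderiv_foot hne hφ hv, S.fderiv_footDir hne hφ hv, hφd v hv, height_fderiv_of_principal hX,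
    h6, S.fderiv_fst_of_principal hne hv hX, S.fderiv_horDir_of_principal hne hv hX hk, foot,
    footDir]
  constructor <;> module

end IsLocalSurface

/-- A surface on which the projection of `∂ₜ` is principal has the normal form near every point,
with the height as first coordinate. -/
theorem IsLocalSurface.exists_normalForm {g n : Plane → Amb} {U : Set Plane}
    (S₀ : IsLocalSurface g n U) (hne₀ : ∀ v ∈ U, (n v).2 ^ 2 ≠ 1)
    (hP₀ : ∀ v ∈ U, IsLocallyPrincipal g n v) {v₀ : Plane} (hv₀U : v₀ ∈ U) :
    ∃ (κ : OpenPartialHomeomorph Plane Plane) (K : Fin 2 → Set ℝ) (f : ℝ → Mink) (φ : ℝ → ℝ),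
      IsBoxChart κ K ∧ v₀ ∈ κ.source ∧ κ.source ⊆ U ∧ ContDiffOn ℝ ∞ f (K 1) ∧
      (∀ y ∈ K 1, f y ∈ hyp ∧ deriv f y ≠ 0) ∧ ContDiffOn ℝ ∞ φ (K 0) ∧
      (∀ v ∈ κ.source, HasDerivAt φ ((n v).2 / Real.sqrt (1 - (n v).2 ^ 2)) (κ v 0)) ∧
      ∀ v ∈ κ.source, g v = (Real.cosh (φ (κ v 0)) • f (κ v 1) +
        Real.sinh (φ (κ v 0)) • curveNormal f (κ v 1), κ v 0) := by
  obtain ⟨U', I, ψ, hU', hUU', hv₀, hI, hψ, hψ0, hψd⟩ := S₀.exists_primitive hne₀ hP₀ hv₀U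
  have S := S₀.mono hU' hUU'
  have hne : ∀ v ∈ U', (n v).2 ^ 2 ≠ 1 := fun v hv => hne₀ v (hUU' hv)
  set φ : Plane → ℝ := fun v => ψ (g v).2 with hφdef
  have hφ : ContDiffOn ℝ ∞ φ U' := hψ.comp S.smooth.snd fun v hv => (hψd v hv).1
  have hφd : ∀ v ∈ U', ∀ Z, fderiv ℝ φ v Z =
      (n v).2 / Real.sqrt (1 - (n v).2 ^ 2) * (fderiv ℝ g v Z).2 := by
    intro v hv Z
    have h : HasFDerivAt φ _ v := (hψd v hv).2.comp_hasFDerivAt v (S.hasFDerivAt_height hv)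
    rw [h.fderiv]
    rfl
  set P := foot g n φ with hPdef
  set Q := footDir g n φ with hQdef
  have hPs : ContDiffOn ℝ ∞ P U' := S.contDiffOn_foot hne hφ
  have hQs : ContDiffOn ℝ ∞ Q U' := S.contDiffOn_footDir hne hφ
  have hPd : ∀ v ∈ U', HasFDerivAt P (fderiv ℝ P v) v := fun v hv =>
    ((hPs.contDiffAt (S.mem_nhds hv)).differentiableAt (by simp)).hasFDerivAt
  -- The primitive is normalized at `v₀`, so there the foot is the point itself, and nondegeneracy
  -- of the foot map at `v₀` comes from the immersion.
  have hφ0 : φ v₀ = 0 := hψ0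
  have hP0 : P v₀ = (g v₀).1 := by simp [hPdef, foot, hφ0]
  have hQ0 : Q v₀ = horDir n v₀ := by simp [hQdef, footDir, hφ0]
  -- a direction in which the height is stationary and the foot is not
  obtain ⟨Y, hY0, hY⟩ := exists_ne_zero_apply_eq_zero (fderiv ℝ (fun w => (g w).2) v₀)
  rw [S.fderiv_height hv₀] at hY
  have hPY : fderiv ℝ P v₀ Y = (fderiv ℝ g v₀ Y).1 := by
    rw [hPdef, S.fderiv_foot hne hφ hv₀, hφd v₀ hv₀, hY]
    simp [hφ0]
  have ha : fderiv ℝ P v₀ Y ≠ 0 := by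
    intro h
    rw [hPY] at h
    apply hY0
    exact S.immersion v₀ hv₀ ((Prod.ext h hY : fderiv ℝ g v₀ Y = 0).trans (map_zero _).symm)
  obtain ⟨i, hi⟩ : ∃ i, fderiv ℝ P v₀ Y i ≠ 0 := by
    by_contra h
    push Not at h
    exact ha (funext h)
  set D := lor (Q v₀) (lorCross (P v₀) (fderiv ℝ P v₀ Y)) with hD
  have hD0 : D ≠ 0 := by
    have h1 := S.lor_fderiv hv₀ Y
    rw [lor_comm] at h1
    have h2 := S.lor_fderiv_foot hne hφ hφd hv₀ Y
    rw [lor_comm] at h2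
    have h3 := S.lor_lorCross_ne_zero hv₀ ha (by rw [hPY]; exact h1) (E := Q v₀)
      (by rw [hQ0]; exact S.lor_horDir_self hne hv₀) (by rw [hQ0]; exact S.lor_horDir hv₀) h2
    rwa [← hP0] at h3
  -- The coordinate `y` will be `σ` times a component of the foot. The sign of `σ` orients the base
  -- curve so that `footDir` becomes `N_f` and not `-N_f`; its size is irrelevant.
  obtain ⟨σ, hσ⟩ : ∃ σ : ℝ, 0 < D * (σ * fderiv ℝ P v₀ Y i) :=
    ⟨D * fderiv ℝ P v₀ Y i, by
      have := sq_pos_of_ne_zero (mul_ne_zero hD0 hi)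
      linarith⟩
  set b : Plane → ℝ := fun v => σ * P v i with hb
  have hbs : ContDiffOn ℝ ∞ b U' := contDiffOn_const.mul (contDiffOn_pi.1 hPs i)
  have hbd : ∀ v ∈ U', ∀ Z, fderiv ℝ b v Z = σ * fderiv ℝ P v Z i := by
    intro v hv Z
    rw [((hasFDerivAt_pi'.1 (hPd v hv) i).const_mul σ).fderiv]
    rfl
  obtain ⟨X, hX, k, hk⟩ := hP₀ v₀ hv₀U
  obtain ⟨κ, K, hκ, hκ₀, hκU, hκc⟩ := exists_isBoxChart hU' (a := fun w => (g w).2) (b := b)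
    S.smooth.snd hbs hv₀ (X := X) (Y := Y)
    (by
      rw [S.fderiv_height hv₀, height_fderiv_of_principal hX]
      exact (S.one_sub_sq_pos hv₀ (hne v₀ hv₀)).ne')
    (by
      rw [hbd v₀ hv₀, (S.fderiv_foot_of_principal hne hφ hφd hv₀ hX hk).1]
      simp)
    (by
      rw [hbd v₀ hv₀]
      intro h
      rw [h, mul_zero] at hσ
      exact lt_irrefl _ hσ)
  have hκ1 : ∀ v ∈ κ.source, ∀ Z, fderiv ℝ (fun w => κ w 1) v Z = σ * fderiv ℝ P v Z i := by
    intro v hv Z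
    rw [← hbd v (hκU hv)]
    have he : (fun w => κ w 1) =ᶠ[nhds v] b := by
      filter_upwards [κ.open_source.mem_nhds hv] with w hw using (hκc w hw).2
    rw [he.fderiv_eq]
  have hkill : ∀ v ∈ κ.source, ∃ X ≠ 0, fderiv ℝ (fun w => κ w 1) v X = 0 ∧
      fderiv ℝ P v X = 0 ∧ fderiv ℝ Q v X = 0 := by
    intro v hv
    have hvU := hκU hv
    obtain ⟨X, hX, k, hk⟩ := hP₀ v (hUU' hvU)
    obtain ⟨h1, h2⟩ := S.fderiv_foot_of_principal hne hφ hφd hvU hX hk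
    refine ⟨X, ?_, ?_, h1, h2⟩
    · rintro rfl
      have h3 := height_fderiv_of_principal hX
      rw [map_zero] at h3
      exact (S.one_sub_sq_pos hvU (hne v hvU)).ne h3
    · rw [hκ1 v hv, h1]; simp
  obtain ⟨f, hf, hPf⟩ := hκ.exists_eq_comp (hPs.mono hκU) 1
    (fun v hv => by obtain ⟨X, h1, h2, h3, -⟩ := hkill v hv; exact ⟨X, h1, h2, h3⟩) hκ₀
  obtain ⟨N, hN, hQN⟩ := hκ.exists_eq_comp (hQs.mono hκU) 1
    (fun v hv => by obtain ⟨X, h1, h2, -, h3⟩ := hkill v hv; exact ⟨X, h1, h2, h3⟩) hκ₀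
  have hK : ∀ v ∈ κ.source, ∀ j, κ v j ∈ K j := by
    intro v hv
    have := κ.map_source hv
    rwa [hκ.target] at this
  have hfd : ∀ y ∈ K 1, HasDerivAt f (deriv f y) y := fun y hy =>
    hasDerivAt_of_contDiffOn (hκ.isOpen 1) hf hy
  have hchain : ∀ v ∈ κ.source, ∀ Z,
      fderiv ℝ P v Z = fderiv ℝ (fun w => κ w 1) v Z • deriv f (κ v 1) := by
    intro v hv Z
    have he : P =ᶠ[nhds v] fun w => f (κ w 1) := by
      filter_upwards [κ.open_source.mem_nhds hv] with w hw using hPf w hw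
    have h1 : HasFDerivAt (fun w => κ w 1) (fderiv ℝ (fun w => κ w 1) v) v :=
      (hasFDerivAt_plane_apply (hκ.hasFDerivAt hv) 1).differentiableAt.hasFDerivAt
    have h2 : HasFDerivAt (fun w => f (κ w 1)) _ v :=
      (hfd _ (hK v hv 1)).hasFDerivAt.comp v h1
    rw [he.fderiv_eq, h2.fderiv]
    simp
  have hfacts : ∀ v ∈ κ.source, f (κ v 1) ∈ hyp ∧ deriv f (κ v 1) ≠ 0 ∧
      lor (N (κ v 1)) (N (κ v 1)) = 1 ∧ lor (N (κ v 1)) (f (κ v 1)) = 0 ∧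
      lor (N (κ v 1)) (deriv f (κ v 1)) = 0 := by
    intro v hv
    obtain ⟨-, h2, h3, h4⟩ := S.lor_foot (φ := φ) hne (hκU hv)
    rw [← hPdef, hPf v hv] at h4 h3
    rw [← hQdef, hQN v hv] at h3 h2
    obtain ⟨Z, hZ⟩ := hκ.exists_fderiv_apply_ne_zero hv 1
    have hc := hchain v hv Z
    refine ⟨h4, ?_, h2, h3, ?_⟩
    -- Since `y` is itself `σ` times a component of the foot, `f' = 0` would force `dy = 0`.
    · intro h
      rw [h, smul_zero] at hc
      apply hZ
      rw [hκ1 v hv, hc]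
      simp
    · have h5 := S.lor_fderiv_foot hne hφ hφd (hκU hv) Z
      rw [← hPdef, ← hQdef, hc, lor_smul_left, hQN v hv] at h5
      rw [lor_comm]
      exact (mul_eq_zero.1 h5).resolve_left hZ
  have hfacts' : ∀ y ∈ K 1, f y ∈ hyp ∧ deriv f y ≠ 0 ∧ lor (N y) (N y) = 1 ∧
      lor (N y) (f y) = 0 ∧ lor (N y) (deriv f y) = 0 := by
    intro y hy
    obtain ⟨v, hv, rfl⟩ := hκ.exists_apply_eq hκ₀ hy
    exact hfacts v hv
  have hff' : ∀ y ∈ K 1, lor (f y) (deriv f y) = 0 := fun y hy =>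
    lor_deriv_eq_zero (hκ.isOpen 1) hf (fun y hy => (hfacts' y hy).1) hy
  obtain ⟨τ, hτ, hτ'⟩ := exists_sign_of_ne_zero (s := K 1)
    (h := fun y => lor (N y) (lorCross (f y) (deriv f y)))
    (hκ.interval 1).isPreconnected
    (contDiffOn_lor hN (contDiffOn_lorCross hf
      ((contDiffOn_infty_iff_deriv_of_isOpen (hκ.isOpen 1)).1 hf).2)).continuousOn (by
      intro y hy h0
      obtain ⟨h1, h2, h3, h4, h5⟩ := hfacts' y hy
      have h6 := congrArg (lor (N y)) (lorCross_parallel h4 h5)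
      have h7 := lor_self_pos h1 h2 (hff' y hy)
      rw [h0, zero_smul, lor_zero_right, lor_smul_right, h3, mul_one, lor_lorCross_self,
        hff' y hy, h1.1] at h6
      linarith)
  -- By the chain rule `D` is `dy(Y) = σ dP(Y)ᵢ` times `⟨N, f ⊠ f'⟩` at `v₀`, so the choice of `σ`
  -- makes the latter positive there, and hence on all of `K 1`.
  have hτ1 : τ = 1 := by
    rcases hτ with h | h
    · exact h
    · exfalso
      have h1 := hτ' _ (hK v₀ hκ₀ 1)
      have h2 := hchain v₀ hκ₀ Y
      have hcr : ∀ (r : ℝ) (u w : Mink), lorCross u (r • w) = r • lorCross u w := by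
        intro r u w
        refine mink_ext ?_ ?_ ?_ <;> simp [lorCross] <;> ring
      have h3 : D = fderiv ℝ (fun w => κ w 1) v₀ Y *
          lor (N (κ v₀ 1)) (lorCross (f (κ v₀ 1)) (deriv f (κ v₀ 1))) := by
        rw [hD, h2, hcr, lor_smul_right, hQN v₀ hκ₀, hPf v₀ hκ₀]
      rw [h] at h1
      rw [h3, hκ1 v₀ hκ₀] at hσ
      nlinarith [sq_nonneg (σ * fderiv ℝ P v₀ Y i)]
  have hNf : ∀ y ∈ K 1, N y = curveNormal f y := by
    intro y hy
    obtain ⟨h1, h2, h3, h4, h5⟩ := hfacts' y hy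
    have h6 := hτ' y hy
    rw [hτ1, one_mul] at h6
    exact eq_curveNormal h1 h2 (hff' y hy) h3 h4 h5 h6
  have hκ0 : ∀ v ∈ κ.source, κ v 0 = (g v).2 := fun v hv => (hκc v hv).1
  refine ⟨κ, K, f, ψ, hκ, hκ₀, fun v hv => hUU' (hκU hv), hf,
    fun y hy => ⟨(hfacts' y hy).1, (hfacts' y hy).2.1⟩, ?_, ?_, ?_⟩
  · refine hψ.mono fun x hx => ?_
    obtain ⟨v, hv, rfl⟩ := hκ.exists_apply_eq hκ₀ hx
    rw [hκ0 v hv]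
    exact (hψd v (hκU hv)).1
  · intro v hv
    rw [hκ0 v hv]
    exact (hψd v (hκU hv)).2
  · intro v hv
    have h1 := fst_eq_foot g n φ v
    rw [← hPdef, ← hQdef, hPf v hv, hQN v hv, hNf _ (hK v hv 1)] at h1
    rw [hκ0 v hv]
    exact Prod.ext h1 rfl

/-! ### Surfaces in charts -/

/-- The linear form whose kernel is the tangent plane of a surface through `q` with normal `ν`. -/
def tangentForm (q ν : Amb) : Amb →ₗ[ℝ] ℝ × ℝ where
  toFun w := (lor w.1 q.1, metric w ν)
  map_add' v w := by
    ext1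
    · simp [lor_add_left]
    · simp only [metric, Prod.fst_add, Prod.snd_add, lor_add_left]; ring
  map_smul' r v := by
    ext1
    · simp [lor_smul_left]
    · simp only [metric, Prod.smul_fst, Prod.smul_snd, lor_smul_left, smul_eq_mul,
        RingHom.id_apply]
      ring

section

variable {M : Type*} [TopologicalSpace M] [ChartedSpace (EuclideanSpace ℝ (Fin 2)) M]

/-- In terms of the differential of `F`: the projection of `∂ₜ` is principal or zero at `p`. -/
def IsPrincipalAt (F ξ : M → Amb) (p : M) : Prop :=
  ∃ X : TangentSpace (𝓡 2) p, diff F p X = dt - (ξ p).2 • ξ p ∧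
    ∃ k : ℝ, proj (F p) (diff ξ p X) = k • diff F p X

omit [TopologicalSpace M] [ChartedSpace (EuclideanSpace ℝ (Fin 2)) M] in
theorem angle_eq (ξ : M → Amb) (p : M) : angle ξ p = Real.arccos (ξ p).2 := by
  rw [angle, metric_dt]

omit [TopologicalSpace M] [ChartedSpace (EuclideanSpace ℝ (Fin 2)) M] in
theorem snd_of_angle_ne {ξ : M → Amb} {p : M}
    (h : angle ξ p ≠ 0 ∧ angle ξ p ≠ Real.pi / 2 ∧ angle ξ p ≠ Real.pi) :
    (ξ p).2 ≠ 0 ∧ (ξ p).2 ^ 2 < 1 := by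
  rw [angle_eq] at h
  obtain ⟨h1, h2, h3⟩ := h
  have h4 : (ξ p).2 < 1 := by
    by_contra h; exact h1 (Real.arccos_eq_zero.2 (not_lt.1 h))
  have h5 : -1 < (ξ p).2 := by
    by_contra h; exact h3 (Real.arccos_eq_pi.2 (not_lt.1 h))
  refine ⟨fun h => h2 (by rw [h, Real.arccos_zero]), by nlinarith⟩

/-- The differential of a map in a chart. -/
theorem diff_eq_fderiv [IsManifold (𝓡 2) ∞ M]
    {e : OpenPartialHomeomorph M (EuclideanSpace ℝ (Fin 2))}
    (he : e ∈ IsManifold.maximalAtlas (𝓡 2) ∞ M) {p : M} (hp : p ∈ e.source) :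
    ∃ L : TangentSpace (𝓡 2) p ≃L[ℝ] Plane, ∀ H : M → Amb, ContMDiff (𝓡 2) 𝓘(ℝ, Amb) ∞ H →
      ∀ X, diff H p X = fderiv ℝ (H ∘ e.symm) (e p) (L X) := by
  have hd : e.MDifferentiable (𝓡 2) (𝓡 2) :=
    ⟨(contMDiffOn_of_mem_maximalAtlas he).mdifferentiableOn (by simp),
      (contMDiffOn_symm_of_mem_maximalAtlas he).mdifferentiableOn (by simp)⟩
  refine ⟨hd.mfderiv hp, fun H hH X => ?_⟩
  have h1 : H =ᶠ[nhds p] (H ∘ e.symm) ∘ e := by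
    filter_upwards [e.open_source.mem_nhds hp] with q hq
    simp [e.left_inv hq]
  have h2 : MDifferentiableAt (𝓡 2) 𝓘(ℝ, Amb) (H ∘ e.symm) (e p) :=
    ((hH.mdifferentiable (by simp)) _).comp (e p) (hd.mdifferentiableAt_symm (e.map_source hp))
  have h3 := mfderiv_comp p h2 (hd.mdifferentiableAt hp)
  rw [← h1.mfderiv_eq, mfderiv_eq_fderiv] at h3
  exact congrArg (fun l : TangentSpace (𝓡 2) p →L[ℝ] Amb => l X) h3

namespace IsOrientedSurface

variable {F ξ : M → Amb} (hF : IsOrientedSurface F ξ)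
include hF

theorem isLocalSurface [IsManifold (𝓡 2) ∞ M]
    {e : OpenPartialHomeomorph M (EuclideanSpace ℝ (Fin 2))}
    (he : e ∈ IsManifold.maximalAtlas (𝓡 2) ∞ M) :
    IsLocalSurface (F ∘ e.symm) (ξ ∘ e.symm) e.target := by
  have hsm : ∀ H : M → Amb, ContMDiff (𝓡 2) 𝓘(ℝ, Amb) ∞ H →
      ContDiffOn ℝ ∞ (H ∘ e.symm) e.target := fun H hH =>
    (hH.comp_contMDiffOn (contMDiffOn_symm_of_mem_maximalAtlas he)).contDiffOn
  refine ⟨e.open_target, hsm F hF.smooth, fun v _ => hF.mem _, fun v hv => ?_,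
    hsm ξ hF.smooth_normal, fun v _ => hF.tangent _, fun v _ => hF.unit _, fun v hv X => ?_⟩
  · obtain ⟨L, hL⟩ := diff_eq_fderiv he (e.map_target hv)
    have h := hL F hF.smooth
    rw [e.right_inv hv] at h
    intro X Y hXY
    rw [← L.apply_symm_apply X, ← L.apply_symm_apply Y, ← h, ← h] at hXY
    exact L.symm.injective (hF.immersion _ hXY)
  · obtain ⟨L, hL⟩ := diff_eq_fderiv he (e.map_target hv)
    have h := hL F hF.smooth
    rw [e.right_inv hv] at h
    rw [← L.apply_symm_apply X, ← h]
    exact hF.normal _ _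

/-- Both sides ask for a tangent vector subject to equations in the differentials, and the
differential of the chart matches the vectors bijectively. -/
theorem isPrincipalAt_iff [IsManifold (𝓡 2) ∞ M]
    {e : OpenPartialHomeomorph M (EuclideanSpace ℝ (Fin 2))}
    (he : e ∈ IsManifold.maximalAtlas (𝓡 2) ∞ M) {p : M} (hp : p ∈ e.source) :
    IsPrincipalAt F ξ p ↔ IsLocallyPrincipal (F ∘ e.symm) (ξ ∘ e.symm) (e p) := by
  obtain ⟨L, hL⟩ := diff_eq_fderiv he hp
  unfold IsPrincipalAt IsLocallyPrincipal
  simp only [hL F hF.smooth, hL ξ hF.smooth_normal, Function.comp_apply, e.left_inv hp]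
  constructor
  · rintro ⟨X, h⟩
    exact ⟨L X, h⟩
  · rintro ⟨Y, h⟩
    refine ⟨L.symm Y, ?_⟩
    rw [L.apply_symm_apply]
    exact h

theorem lor_diff [IsManifold (𝓡 2) ∞ M] (p : M) (X : TangentSpace (𝓡 2) p) :
    lor (diff F p X).1 (F p).1 = 0 := by
  have he := IsManifold.chart_mem_maximalAtlas (I := 𝓡 2) (n := ∞) p
  have hp := mem_chart_source (EuclideanSpace ℝ (Fin 2)) p
  obtain ⟨L, hL⟩ := diff_eq_fderiv he hp
  have := (hF.isLocalSurface he).lor_fderiv ((chartAt _ p).map_source hp) (L X)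
  rwa [← hL F hF.smooth, Function.comp_apply, (chartAt _ p).left_inv hp] at this

theorem metric_diff_normal [IsManifold (𝓡 2) ∞ M] (p : M) (X : TangentSpace (𝓡 2) p) :
    metric (diff ξ p X) (ξ p) = 0 := by
  have he := IsManifold.chart_mem_maximalAtlas (I := 𝓡 2) (n := ∞) p
  have hp := mem_chart_source (EuclideanSpace ℝ (Fin 2)) p
  obtain ⟨L, hL⟩ := diff_eq_fderiv he hp
  have := (hF.isLocalSurface he).metric_fderiv_normal ((chartAt _ p).map_source hp) (L X)
  rwa [← hL ξ hF.smooth_normal, Function.comp_apply, (chartAt _ p).left_inv hp] at this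

/-- The image of the differential of `F` is the orthogonal complement of the normal in the tangent
space of `ℍ² × ℝ`. -/
theorem exists_diff_eq [IsManifold (𝓡 2) ∞ M] (p : M) {w : Amb} (hw : lor w.1 (F p).1 = 0)
    (hw' : metric w (ξ p) = 0) : ∃ X, diff F p X = w := by
  let Λ := tangentForm (F p) (ξ p)
  -- The position vector and the normal map to `(-1, 0)` and `(0, 1)`. The kernel of `Λ` thus has
  -- dimension `4 - 2 = 2`, the rank of the differential.
  have hsurj : Function.Surjective Λ := by
    rintro ⟨a, b⟩
    refine ⟨(-a) • ((F p).1, (0 : ℝ)) + b • ξ p, ?_⟩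
    have h1 : Λ ((F p).1, (0 : ℝ)) = (-1, 0) := by
      have h2 := hF.tangent p
      rw [lor_comm] at h2
      exact Prod.ext (hF.mem p).1 (by simp [Λ, tangentForm, metric, h2])
    have h2 : Λ (ξ p) = (0, 1) := Prod.ext (hF.tangent p) (hF.unit p)
    rw [map_add, map_smul, map_smul, h1, h2]
    simp
  have hle : (diff F p).toLinearMap.range ≤ LinearMap.ker Λ := by
    rintro _ ⟨X, rfl⟩
    exact Prod.ext (hF.lor_diff p X) (hF.normal p X)
  have h1 := Λ.finrank_range_add_finrank_ker
  rw [LinearMap.range_eq_top.2 hsurj] at h1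
  have h2 : Module.finrank ℝ (diff F p).toLinearMap.range = 2 := by
    rw [LinearMap.finrank_range_of_inj (hF.immersion p)]
    exact finrank_euclideanSpace_fin
  have h3 : Module.finrank ℝ Amb = 4 := by simp
  have h4 : Module.finrank ℝ (ℝ × ℝ) = 2 := by simp
  rw [finrank_top, h3, h4] at h1
  have h5 := Submodule.eq_of_le_of_finrank_eq hle (by omega)
  have h6 : w ∈ LinearMap.ker Λ := Prod.ext hw hw'
  rw [← h5] at h6
  exact h6

omit hF in
theorem diff_pull {p : M} {w : Amb} (h : ∃ X, diff F p X = w) : diff F p (pull F p w) = w :=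
  @Function.invFun_eq _ _ ⟨0⟩ _ _ h

theorem cos_angle (p : M) : Real.cos (angle ξ p) = (ξ p).2 ∧
    Real.sin (angle ξ p) = Real.sqrt (1 - (ξ p).2 ^ 2) := by
  have h1 := lor_self_nonneg (hF.mem p) (by rw [lor_comm]; exact hF.tangent p)
  have h2 := hF.unit p
  unfold metric at h2
  have h3 : |(ξ p).2| ≤ 1 := by
    rw [← sq_le_one_iff_abs_le_one]; linarith
  rw [angle_eq]
  exact ⟨Real.cos_arccos (abs_le.1 h3).1 (abs_le.1 h3).2, Real.sin_arccos _⟩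

theorem diff_tangentPart [IsManifold (𝓡 2) ∞ M] (p : M) :
    diff F p (tangentPart F ξ p) = dt - (ξ p).2 • ξ p := by
  rw [tangentPart, (hF.cos_angle p).1]
  refine diff_pull (hF.exists_diff_eq p ?_ ?_)
  · simp only [dt, Prod.fst_sub, Prod.smul_fst, lor_sub_left, lor_smul_left, hF.tangent p,
      lor_zero_left]
    ring
  · have := hF.unit p
    simp only [metric, dt, Prod.fst_sub, Prod.smul_fst, Prod.snd_sub, Prod.smul_snd, lor_sub_left,
      lor_smul_left, lor_zero_left, smul_eq_mul] at this ⊢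
    linear_combination (-(ξ p).2) * this

theorem diff_shapeOp [IsManifold (𝓡 2) ∞ M] (p : M) (X : TangentSpace (𝓡 2) p) :
    diff F p (shapeOp F ξ p X) = -proj (F p) (diff ξ p X) := by
  refine diff_pull (hF.exists_diff_eq p ?_ ?_)
  · have := (hF.mem p).1
    simp only [covDeriv, proj, Prod.fst_neg, lor_neg_left, lor_add_left, lor_smul_left, this]
    ring
  · have h1 := hF.metric_diff_normal p X
    have h2 := hF.tangent p
    rw [lor_comm] at h2
    simp only [metric, covDeriv, proj, Prod.fst_neg, Prod.snd_neg, lor_neg_left, lor_add_left,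
      lor_smul_left, h2] at h1 ⊢
    linear_combination -h1

/-- Injectivity of `dF` identifies the vector `X` with `T`, and the sign in the Weingarten formula
replaces `k` by `-k`. That `T ≠ 0` is automatic, its height component being `sin² θ`. -/
theorem isPrincipalT_iff [IsManifold (𝓡 2) ∞ M] (hne : ∀ p, (ξ p).2 ^ 2 < 1) :
    IsPrincipalT F ξ ↔ ∀ p, IsPrincipalAt F ξ p := by
  refine forall_congr' fun p => ⟨?_, ?_⟩
  · rintro ⟨-, k, hk⟩
    refine ⟨_, hF.diff_tangentPart p, -k, ?_⟩
    have := hF.diff_shapeOp p (tangentPart F ξ p)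
    rw [hk, map_smul] at this
    rw [neg_smul, this, neg_neg]
  · rintro ⟨X, hX, k, hk⟩
    have hT : tangentPart F ξ p = X := hF.immersion p ((hF.diff_tangentPart p).trans hX.symm)
    rw [hT]
    refine ⟨?_, -k, ?_⟩
    · rintro rfl
      rw [map_zero] at hX
      have h2 := congrArg Prod.snd hX
      simp only [dt, Prod.snd_zero, Prod.snd_sub, Prod.smul_snd, smul_eq_mul] at h2
      have := hne p
      nlinarith
    · apply hF.immersion p
      rw [hF.diff_shapeOp, hk, map_smul, neg_smul]

end IsOrientedSurface

/-! ### Rigid motions -/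

namespace RigidMotion

/-- The differential of a rigid motion, as a continuous linear map. -/
noncomputable def dactL (Φ : RigidMotion) : Amb →L[ℝ] Amb :=
  (LinearMap.toContinuousLinearMap (Φ.lin : Mink →ₗ[ℝ] Mink)).prodMap
    (Φ.sgn • ContinuousLinearMap.id ℝ ℝ)

theorem dactL_apply (Φ : RigidMotion) (v : Amb) : Φ.dactL v = Φ.dact v := rfl

theorem act_eq (Φ : RigidMotion) (q : Amb) : Φ.act q = Φ.dactL q + (0, Φ.shift) := by
  ext1
  · exact (add_zero _).symm
  · rfl

theorem sgn_sq (Φ : RigidMotion) : Φ.sgn * Φ.sgn = 1 := by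
  rcases Φ.sgn_eq with h | h <;> rw [h] <;> norm_num

theorem metric_dact (Φ : RigidMotion) (v w : Amb) : metric (Φ.dact v) (Φ.dact w) = metric v w := by
  simp only [metric, dact, Φ.lin_lor]
  linear_combination v.2 * w.2 * Φ.sgn_sq

theorem dactL_injective (Φ : RigidMotion) : Function.Injective Φ.dactL := by
  intro v w h
  have h1 : Φ.lin v.1 = Φ.lin w.1 := congrArg Prod.fst h
  have h2 : Φ.sgn * v.2 = Φ.sgn * w.2 := congrArg Prod.snd h
  refine Prod.ext (Φ.lin.injective h1) ?_
  linear_combination Φ.sgn * h2 - (v.2 - w.2) * Φ.sgn_sq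

theorem proj_act (Φ : RigidMotion) (q v : Amb) :
    proj (Φ.act q) (Φ.dactL v) = Φ.dactL (proj q v) := by
  refine Prod.ext ?_ rfl
  change Φ.lin v.1 + lor (Φ.lin v.1) (Φ.lin q.1) • Φ.lin q.1 = Φ.lin (v.1 + lor v.1 q.1 • q.1)
  rw [Φ.lin_lor, map_add, map_smul]

theorem hasFDerivAt_act (Φ : RigidMotion) (q : Amb) : HasFDerivAt Φ.act Φ.dactL q := by
  have : Φ.act = fun q => Φ.dactL q + (0, Φ.shift) := funext Φ.act_eq
  rw [this]
  exact Φ.dactL.hasFDerivAt.add_const _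

theorem contDiff_act (Φ : RigidMotion) : ContDiff ℝ ∞ Φ.act := by
  have : Φ.act = fun q => Φ.dactL q + (0, Φ.shift) := funext Φ.act_eq
  rw [this]
  exact Φ.dactL.contDiff.add contDiff_const

theorem diff_comp {G : Amb → Amb} {G' : Amb →L[ℝ] Amb} {H : M → Amb} {p : M}
    (hG : HasFDerivAt G G' (H p)) (hH : ContMDiff (𝓡 2) 𝓘(ℝ, Amb) ∞ H)
    (X : TangentSpace (𝓡 2) p) : diff (fun q => G (H q)) p X = G' (diff H p X) := by
  have h := mfderiv_comp (I' := 𝓘(ℝ, Amb)) p hG.differentiableAt.mdifferentiableAt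
    ((hH.mdifferentiable (by simp)) p)
  rw [mfderiv_eq_fderiv, hG.fderiv] at h
  exact congrArg (fun l : TangentSpace (𝓡 2) p →L[ℝ] Amb => l X) h

theorem isOrientedSurface (Φ : RigidMotion) {F ξ : M → Amb} (hF : IsOrientedSurface F ξ) :
    IsOrientedSurface (fun q => Φ.act (F q)) (fun q => Φ.dact (ξ q)) := by
  refine ⟨Φ.contDiff_act.contMDiff.comp hF.smooth, fun p => Φ.lin_mem _ (hF.mem p), fun p => ?_,
    Φ.dactL.contDiff.contMDiff.comp hF.smooth_normal, fun p => ?_, fun p => ?_, fun p X => ?_⟩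
  · intro X Y h
    rw [diff_comp (Φ.hasFDerivAt_act _) hF.smooth, diff_comp (Φ.hasFDerivAt_act _) hF.smooth] at h
    exact hF.immersion p (Φ.dactL_injective h)
  · exact (Φ.lin_lor _ _).trans (hF.tangent p)
  · rw [Φ.metric_dact, hF.unit]
  · rw [diff_comp (Φ.hasFDerivAt_act _) hF.smooth, dactL_apply, Φ.metric_dact, hF.normal]

theorem isPrincipalAt_of_act (Φ : RigidMotion) {F ξ : M → Amb} (hF : IsOrientedSurface F ξ) {p : M}
    (h : IsPrincipalAt (fun q => Φ.act (F q)) (fun q => Φ.dact (ξ q)) p) :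
    IsPrincipalAt F ξ p := by
  obtain ⟨X, hX, k, hk⟩ := h
  have hd : diff (fun q => Φ.dact (ξ q)) p X = Φ.dactL (diff ξ p X) :=
    diff_comp Φ.dactL.hasFDerivAt hF.smooth_normal X
  rw [diff_comp (Φ.hasFDerivAt_act _) hF.smooth] at hX hk
  rw [hd, Φ.proj_act, ← map_smul] at hk
  -- The motion sends `∂ₜ` to `sgn ∂ₜ`, so the `T` of the moved surface is `sgn` times the original
  -- one; the factor `k` is unchanged.
  refine ⟨Φ.sgn • X, Φ.dactL_injective ?_, k, ?_⟩
  · rw [map_smul, map_smul, hX, map_sub, map_smul, dactL_apply, dactL_apply]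
    have := Φ.sgn_sq
    ext1
    · simp only [dact, dt, Prod.smul_fst, Prod.fst_sub, zero_sub, map_zero, smul_neg, smul_smul]
      rw [← mul_assoc, this, one_mul]
    · simp only [dact, dt, Prod.smul_snd, Prod.snd_sub, smul_eq_mul]
      linear_combination (-Φ.sgn * (ξ p).2 ^ 2) * this
  · have := Φ.dactL_injective hk
    rw [map_smul, map_smul, smul_comm, ← this]
    simp only [proj, Prod.smul_fst, Prod.smul_snd, lor_smul_left, smul_add, smul_smul,
      Prod.smul_mk]

/-- The identity. -/
def refl : RigidMotion where
  lin := LinearEquiv.refl ℝ Mink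
  lin_lor _ _ := rfl
  lin_mem _ hu := hu
  sgn := 1
  sgn_eq := Or.inl rfl
  shift := 0

theorem refl_act (q : Amb) : refl.act q = q := by
  refine Prod.ext rfl ?_
  simp [act, refl]

theorem refl_dact (q : Amb) : refl.dact q = q := by
  refine Prod.ext rfl ?_
  simp [dact, refl]

end RigidMotion

/-! ### The classification -/

theorem IsNormalForm.isCoordNormalForm {G : M → Amb}
    {e : OpenPartialHomeomorph M (EuclideanSpace ℝ (Fin 2))} {I J : Set ℝ} {f : ℝ → Mink}
    {φ χ : ℝ → ℝ} (h : IsNormalForm G e I J f φ χ) :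
    IsCoordNormalForm (G ∘ e.symm) I J f φ χ where
  isOpen_I := h.isOpen_I
  interval_I := h.interval_I
  isOpen_J := h.isOpen_J
  interval_J := h.interval_J
  smooth_f := h.smooth_f
  f_mem := h.f_mem
  f_regular := h.f_regular
  smooth_φ := h.smooth_φ
  smooth_χ := h.smooth_χ
  regular := h.regular
  formula v h0 h1 := by
    have hv : v ∈ e.target := by rw [h.target]; exact ⟨h0, h1⟩
    rw [Function.comp_apply, h.formula _ (e.map_target hv), e.right_inv hv]

theorem IsOrientedSurface.isPrincipalAt_of_isNormalForm [IsManifold (𝓡 2) ∞ M] {F ξ : M → Amb}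
    (hF : IsOrientedSurface F ξ) {e : OpenPartialHomeomorph M (EuclideanSpace ℝ (Fin 2))}
    {I J : Set ℝ} {f : ℝ → Mink} {φ χ : ℝ → ℝ} (h : IsNormalForm F e I J f φ χ) {p : M}
    (hp : p ∈ e.source) : IsPrincipalAt F ξ p := by
  have hS := hF.isLocalSurface h.chart
  have hv := e.map_source hp
  rw [h.target] at hS hv
  exact (hF.isPrincipalAt_iff h.chart hp).2 (h.isCoordNormalForm.isLocallyPrincipal hS hv.1 hv.2)

theorem IsOrientedSurface.exists_signs_of_isNormalForm [IsManifold (𝓡 2) ∞ M] {F ξ : M → Amb}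
    (hF : IsOrientedSurface F ξ) (h0 : ∀ p, (ξ p).2 ≠ 0) (h1 : ∀ p, (ξ p).2 ^ 2 < 1)
    {e : OpenPartialHomeomorph M (EuclideanSpace ℝ (Fin 2))} {I J : Set ℝ} {f : ℝ → Mink}
    {φ χ : ℝ → ℝ} (h : IsNormalForm F e I J f φ χ) :
    ∃ ε δ : ℝ, (ε = 1 ∨ ε = -1) ∧ (δ = 1 ∨ δ = -1) ∧ ∀ q ∈ e.source,
      δ * deriv φ (e q 0) = speed φ χ (e q 0) * Real.cos (angle (fun r => ε • ξ r) q) ∧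
      δ * deriv χ (e q 0) = speed φ χ (e q 0) * Real.sin (angle (fun r => ε • ξ r) q) := by
  have hS := hF.isLocalSurface h.chart
  rw [h.target] at hS
  obtain ⟨ε, δ, hε, hδ, hεδ⟩ := h.isCoordNormalForm.exists_signs hS (fun v _ _ => h0 _)
    (fun v _ _ => (h1 _).ne)
  refine ⟨ε, δ, hε, hδ, fun q hq => ?_⟩
  have hv := e.map_source hq
  rw [h.target] at hv
  have h2 := hεδ _ hv.1 hv.2
  rw [Function.comp_apply, e.left_inv hq] at h2
  have hε2 : ε ^ 2 = 1 := by rcases hε with h | h <;> simp [h]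
  have h3 : |ε * (ξ q).2| ≤ 1 := by
    rw [← sq_le_one_iff_abs_le_one, mul_pow, hε2, one_mul]
    exact (h1 q).le
  have h4 : angle (fun r => ε • ξ r) q = Real.arccos (ε * (ξ q).2) := angle_eq _ _
  rw [h4, Real.cos_arccos (abs_le.1 h3).1 (abs_le.1 h3).2, Real.sin_arccos]
  exact h2

theorem IsOrientedSurface.exists_isNormalForm [IsManifold (𝓡 2) ∞ M] {F ξ : M → Amb}
    (hF : IsOrientedSurface F ξ) (h1 : ∀ p, (ξ p).2 ^ 2 < 1) (hP : ∀ p, IsPrincipalAt F ξ p)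
    (p : M) :
    ∃ (e : OpenPartialHomeomorph M (EuclideanSpace ℝ (Fin 2))) (I J : Set ℝ)
      (f : ℝ → Mink) (φ χ : ℝ → ℝ), p ∈ e.source ∧ IsNormalForm F e I J f φ χ ∧
      ∀ q ∈ e.source, IsCurveAngle φ χ (e q 0) (angle ξ q) := by
  set ρ := chartAt (EuclideanSpace ℝ (Fin 2)) p
  have hρ : ρ ∈ IsManifold.maximalAtlas (𝓡 2) ∞ M := IsManifold.chart_mem_maximalAtlas p
  have hp : p ∈ ρ.source := mem_chart_source _ p
  obtain ⟨κ, K, f, φ, hκ, hκ₀, hκU, hf, hf', hφ, hφd, hform⟩ :=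
    (hF.isLocalSurface hρ).exists_normalForm (fun v _ => (h1 _).ne) (fun v hv => by
      have := (hF.isPrincipalAt_iff hρ (ρ.map_target hv)).1 (hP _)
      rwa [ρ.right_inv hv] at this) (ρ.map_source hp)
  have hsrc : (ρ.trans κ).source = ρ.source ∩ ρ ⁻¹' κ.source := ρ.trans_source κ
  have htgt : (ρ.trans κ).target = κ.target := by
    rw [OpenPartialHomeomorph.trans_target]
    exact Set.inter_eq_left.2 fun v hv => hκU (κ.map_target hv)
  -- The height is the first coordinate, hence `χ = id`, and the plane curve is a graph over the
  -- height with `φ' = cot θ`.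
  refine ⟨ρ.trans κ, K 0, K 1, f, φ, id, ?_, ⟨?_, hκ.isOpen 0, hκ.interval 0, hκ.isOpen 1,
    hκ.interval 1, ?_, hf, fun y hy => (hf' y hy).1, fun y hy => (hf' y hy).2, hφ,
    contDiff_id.contDiffOn, fun x _ => Or.inr (by simp), fun q hq => ?_⟩, fun q hq => ?_⟩
  · rw [hsrc]; exact ⟨hp, hκ₀⟩
  · refine OpenPartialHomeomorph.mem_maximalAtlas_of_contMDiffOn _ ?_ ?_
    · rw [hsrc]
      exact hκ.smooth.contMDiffOn.comp
        ((contMDiffOn_of_mem_maximalAtlas hρ).mono fun q hq => hq.1) fun q hq => hq.2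
    · rw [htgt]
      exact (contMDiffOn_symm_of_mem_maximalAtlas hρ).comp hκ.smooth_symm.contMDiffOn
        fun v hv => hκU (κ.map_target hv)
  · rw [htgt, hκ.target]
    ext v
    simp [Fin.forall_fin_two]
  · rw [hsrc] at hq
    have := hform _ hq.2
    rw [Function.comp_apply, ρ.left_inv hq.1] at this
    exact this
  · rw [hsrc] at hq
    have hd := hφd _ hq.2
    rw [Function.comp_apply, ρ.left_inv hq.1] at hd
    have hs : 0 < Real.sqrt (1 - (ξ q).2 ^ 2) := Real.sqrt_pos.2 (by linarith [h1 q])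
    have hss : Real.sqrt (1 - (ξ q).2 ^ 2) ^ 2 = 1 - (ξ q).2 ^ 2 :=
      Real.sq_sqrt (by linarith [h1 q])
    -- The speed is `√(cot² θ + 1) = 1 / sin θ`, so `(φ', χ') = (cot θ, 1)` is the speed times `(cos
    -- θ, sin θ)` with no sign to adjust.
    have hspeed : speed φ id (κ (ρ q) 0) = (Real.sqrt (1 - (ξ q).2 ^ 2))⁻¹ := by
      rw [speed, hd.deriv, deriv_id]
      rw [Real.sqrt_eq_iff_mul_self_eq (by positivity) (by positivity)]
      field_simp
      linarith
    change deriv φ (κ (ρ q) 0) = speed φ id (κ (ρ q) 0) * _ ∧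
      deriv id (κ (ρ q) 0) = speed φ id (κ (ρ q) 0) * _
    rw [hspeed, hd.deriv, deriv_id, (hF.cos_angle q).1, (hF.cos_angle q).2]
    exact ⟨by field_simp, by field_simp⟩

end

end H2R

theorem theorem5 {M : Type*} [TopologicalSpace M] [ChartedSpace (EuclideanSpace ℝ (Fin 2)) M]
    [IsManifold (𝓡 2) ∞ M] (F ξ : M → Amb) (hF : IsOrientedSurface F ξ)
    (hθ : ∀ p, angle ξ p ≠ 0 ∧ angle ξ p ≠ Real.pi / 2 ∧ angle ξ p ≠ Real.pi) :
    -- `T` is principal iff, up to a rigid motion, `F` is locally of the stated form, with a plane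
    -- curve whose angle function is the one of the surface
    (IsPrincipalT F ξ ↔
      ∃ Φ : RigidMotion, ∀ p : M,
        ∃ (e : OpenPartialHomeomorph M (EuclideanSpace ℝ (Fin 2))) (I J : Set ℝ)
          (f : ℝ → Mink) (φ χ : ℝ → ℝ),
          p ∈ e.source ∧ IsNormalForm (fun q => Φ.act (F q)) e I J f φ χ ∧
          ∀ q ∈ e.source, IsCurveAngle φ χ (e q 0) (angle (fun r => Φ.dact (ξ r)) q)) ∧
    -- for the converse the condition on the angles is not needed, and the rigid motion may depend
    -- on the point
    ((∀ p : M, ∃ (Φ : RigidMotion) (e : OpenPartialHomeomorph M (EuclideanSpace ℝ (Fin 2)))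
        (I J : Set ℝ) (f : ℝ → Mink) (φ χ : ℝ → ℝ),
        p ∈ e.source ∧ IsNormalForm (fun q => Φ.act (F q)) e I J f φ χ) →
      IsPrincipalT F ξ) ∧
    -- in every such representation the angle function of the plane curve is the one of the
    -- surface, up to the choice of the unit normal (`ε`) and of the direction of the curve (`δ`)
    (∀ (Φ : RigidMotion) (e : OpenPartialHomeomorph M (EuclideanSpace ℝ (Fin 2)))
        (I J : Set ℝ) (f : ℝ → Mink) (φ χ : ℝ → ℝ),
        IsNormalForm (fun q => Φ.act (F q)) e I J f φ χ →
        ∃ ε δ : ℝ, (ε = 1 ∨ ε = -1) ∧ (δ = 1 ∨ δ = -1) ∧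
          ∀ q ∈ e.source,
            δ * deriv φ (e q 0) = speed φ χ (e q 0) *
              Real.cos (angle (fun r => ε • Φ.dact (ξ r)) q) ∧
            δ * deriv χ (e q 0) = speed φ χ (e q 0) *
              Real.sin (angle (fun r => ε • Φ.dact (ξ r)) q)) := by
  have h0 : ∀ p, (ξ p).2 ≠ 0 := fun p => (snd_of_angle_ne (hθ p)).1
  have h1 : ∀ p, (ξ p).2 ^ 2 < 1 := fun p => (snd_of_angle_ne (hθ p)).2
  have hconv : (∀ p : M, ∃ (Φ : RigidMotion)
      (e : OpenPartialHomeomorph M (EuclideanSpace ℝ (Fin 2))) (I J : Set ℝ) (f : ℝ → Mink)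
      (φ χ : ℝ → ℝ), p ∈ e.source ∧ IsNormalForm (fun q => Φ.act (F q)) e I J f φ χ) →
      IsPrincipalT F ξ := by
    intro h
    refine (hF.isPrincipalT_iff h1).2 fun p => ?_
    obtain ⟨Φ, e, I, J, f, φ, χ, hp, hN⟩ := h p
    exact Φ.isPrincipalAt_of_act hF ((Φ.isOrientedSurface hF).isPrincipalAt_of_isNormalForm hN hp)
  refine ⟨⟨fun hP => ⟨RigidMotion.refl, fun p => ?_⟩, ?_⟩, hconv, ?_⟩
  · simp only [RigidMotion.refl_act, RigidMotion.refl_dact]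
    exact hF.exists_isNormalForm h1 ((hF.isPrincipalT_iff h1).1 hP) p
  · rintro ⟨Φ, h⟩
    refine hconv fun p => ?_
    obtain ⟨e, I, J, f, φ, χ, hp, hN, -⟩ := h p
    exact ⟨Φ, e, I, J, f, φ, χ, hp, hN⟩
  · intro Φ e I J f φ χ hN
    have hsnd : ∀ p, (Φ.dact (ξ p)).2 = Φ.sgn * (ξ p).2 := fun p => rfl
    refine (Φ.isOrientedSurface hF).exists_signs_of_isNormalForm (fun p => ?_) (fun p => ?_) hN
    · rw [hsnd]
      exact mul_ne_zero (left_ne_zero_of_mul_eq_one Φ.sgn_sq) (h0 p)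
    · rw [hsnd, mul_pow, pow_two, Φ.sgn_sq, one_mul]
      exact h1 p
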